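/- Let $\alpha>0$, $\alpha\neq1$, and consider the two-dimensional Robertson–Walker spacetime $\{(t,\chi):t>0\}$ with metric $ds^2=-dt^2+a(t)^2d\chi^2$, $a(t)=t^\alpha$. The central observer has world line $\tau\mapsto(\tau,0)$ and 4-velocity $u=\partial/\partial t$; a comoving test particle has world line $s\mapsto(s,\chi)$ with $\chi>0$ constant. For $p=(\tau,0)$, the Fermi space slice $\mathcal M_\tau$ consists of the events that are joined to $p$ by a spacelike geodesic $\psi$ orthogonal to $u$ at $p$; an event of $\mathcal M_\tau$ with $\chi>0$ at proper length $\rho>0$ from $p$ along such a geodesic has Fermi coordinates $(\tau,\rho)$. Let $\mathcal S_p=\frac1{a(\tau)}\frac{\partial}{\partial\chi}\big|_p$. The following relative velocities at $p$ are attached to the event $q$ at which the particle meets $\mathcal M_\tau$: the Fermi relative velocity is $v_{\mathrm{Fermi}}=\frac{d\rho}{d\tau}\mathcal S_p$, where $(\tau,\rho)$ are the Fermi coordinates along the world line of the particle; the kinematic relative velocity is $v_{\mathrm{kin}}=\frac{1}{-g(\hat u,u)}\hat u-u$, where $\hat u$ is the parallel transport to $p$ along $\psi$ of the 4-velocity of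 the particle at $q$. Write $\|w\|=\sqrt{g(w,w)}$ and $$v=v(\tau,\chi)=\dot a(\tau)\chi=\alpha\chi\tau^{\alpha-1},\qquad C_\alpha=\frac{\sqrt\pi\,\Gamma\!\left(\frac{1+\alpha}{2\alpha}\right)}{\Gamma\!\left(\frac1{2\alpha}\right)},\qquad v_{\mathrm{smax}}=\begin{cases}\frac{\alpha}{1-\alpha}C_\alpha,&0<\alpha<1,\\ +\infty,&\alpha>1.\end{cases}$$ Let $F_\alpha(z)=z^{\frac{1-\alpha}{\alpha}}\,{}_2F_1\!\left(\frac12,\frac{1-\alpha}{2\alpha};\frac{1+\alpha}{2\alpha};z^2\right)$ for $0<z<1$, where ${}_2F_1$ is the Gauss hypergeometric function, and let $G_\alpha(v)=\left(F_\alpha^{-1}\!\left(C_\alpha+\frac{\alpha-1}{\alpha}v\right)\right)^{1/\alpha}$. Then for all $\tau,\chi>0$ with $v=v(\tau,\chi)<v_{\mathrm{smax}}$, the number $C_\alpha+\frac{\alpha-1}\alpha v$ has exactly one preimage under $F_\alpha$ in $(0,1)$, the relative velocities $v_{\mathrm{kin}}$ and $v_{\mathrm{Fermi}}$ at $p=(\tau,0)$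 of the comoving particle with coordinate $\chi$ exist and are unique, and $$\|v_{\mathrm{kin}}\|=\sqrt{1-G_\alpha(v)^{2\alpha}},$$ $$\|v_{\mathrm{Fermi}}\|=G_\alpha(v)^{1-\alpha}\sqrt{1-G_\alpha(v)^{2\alpha}}-\frac{\alpha-1}{\alpha}\left(1-G_\alpha(v)^{2\alpha}\right)v.$$ Moreover, as $v\to v_{\mathrm{smax}}$ from below (with $\tau,\chi>0$), $$\|v_{\mathrm{kin}}\|\to1,\qquad \|v_{\mathrm{Fermi}}\|\to C_\alpha,$$ and for every $\tau>0$ we have $C_\alpha=\rho_{\mathcal M_\tau}/\tau$, where the (convergent) integral $\rho_{\mathcal M_\tau}=\int_0^\tau\frac{a(t)}{\sqrt{a(\tau)^2-a(t)^2}}\,dt$ is the proper radius of the slice $\mathcal M_\tau$, i.e. the least upper bound of the proper lengths of the geodesic arcs in $\mathcal M_\tau$ that start at $p$ orthogonally to $u$. -/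

import Mathlib

open Set Filter Topology
open scoped Matrix

noncomputable section

namespace RobertsonWalker

/-- Events, in coordinates: `x 0 = t` and `x 1 = χ`. Tangent vectors use the same type, by
their components in the basis `∂/∂t`, `∂/∂χ`. The spacetime is the half plane `t > 0`. -/
abbrev Coord : Type := Fin 2 → ℝ

/-- A metric tensor in a chart: the matrix of components at each event. -/
abbrev MetricTensor : Type := Coord → Matrix (Fin 2) (Fin 2) ℝ

/-- The scalar product `g_x(v, w)` of two tangent vectors at `x`. -/
def scalarProd (g : MetricTensor) (x v w : Coord) : ℝ := v ⬝ᵥ (g x *ᵥ w)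

/-- The partial derivative `∂f/∂x^i` at `x`. -/
def pderiv (i : Fin 2) (f : Coord → ℝ) (x : Coord) : ℝ := fderiv ℝ f x (Pi.single i 1)

/-- The Christoffel symbols `Γ^k_{ij}` of the Levi-Civita connection of `g`. -/
def christoffel (g : MetricTensor) (x : Coord) (k i j : Fin 2) : ℝ :=
  (1 / 2) * ∑ l, (g x)⁻¹ k l *
    (pderiv i (fun y => g y j l) x + pderiv j (fun y => g y i l) x
      - pderiv l (fun y => g y i j) x)

/-- `W` is a parallel vector field along the curve `ψ : [0, ℓ] → M` whose velocity is `V`: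
`dW^k/dr + Γ^k_{ij} V^i W^j = 0`. -/
def IsParallelAlong (g : MetricTensor) (ℓ : ℝ) (ψ V W : ℝ → Coord) : Prop :=
  ∀ r ∈ Icc 0 ℓ, HasDerivWithinAt W
    (fun k => -∑ i, ∑ j, christoffel g (ψ r) k i j * V r i * W r j) (Icc 0 ℓ) r

/-- The two-dimensional Robertson-Walker metric `-dt² + a(t)² dχ²`. -/
def metric (a : ℝ → ℝ) : MetricTensor := fun x => !![-1, 0; 0, a (x 0) ^ 2]

/-- The event `(τ, 0)` of the central observer at its proper time `τ`. -/
def observer (τ : ℝ) : Coord := ![τ, 0]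

/-- The 4-velocity `u = ∂/∂t` of the central observer. -/
def observerVelocity : Coord := ![1, 0]

/-- The unit vector `(1/a(τ)) ∂/∂χ` at the event `(τ, 0)`. -/
def radialUnit (a : ℝ → ℝ) (τ : ℝ) : Coord := ![0, 1 / a τ]

/-- The world line of the comoving test particle with coordinate `χ`, parametrized by its
proper time. -/
def comoving (χ : ℝ) : ℝ → Coord := fun s => ![s, χ]

/-- `ψ : [0, ρ] → M`, with velocity `V`, is a spacelike geodesic arc of proper length `ρ > 0`,
parametrized by proper length, that starts at the event `(τ, 0)` of the central observer
orthogonally to its 4-velocity, towards the side `χ > 0`. -/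
structure IsFermiGeodesic (a : ℝ → ℝ) (τ ρ : ℝ) (ψ V : ℝ → Coord) : Prop where
  tau_pos : 0 < τ
  rho_pos : 0 < ρ
  time_pos : ∀ r ∈ Icc 0 ρ, 0 < ψ r 0
  velocity : ∀ r ∈ Icc 0 ρ, HasDerivWithinAt ψ (V r) (Icc 0 ρ) r
  geodesic : IsParallelAlong (metric a) ρ ψ V V
  start : ψ 0 = observer τ
  orthogonal : scalarProd (metric a) (observer τ) (V 0) observerVelocity = 0
  unit : scalarProd (metric a) (observer τ) (V 0) (V 0) = 1
  outward : 0 < V 0 1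

/-- The event `q` has Fermi coordinates `(τ, ρ)` with respect to the central observer: it lies
on the Fermi space slice of `(τ, 0)`, at proper length `ρ` along the orthogonal geodesic. -/
def HasFermiCoordinates (a : ℝ → ℝ) (q : Coord) (τ ρ : ℝ) : Prop :=
  ∃ ψ V : ℝ → Coord, IsFermiGeodesic a τ ρ ψ V ∧ ψ ρ = q

/-- `w` is the kinematic relative velocity, measured at `p = (τ, 0)`, of the test particle with
world line `γ`. Here `ψ` is the orthogonal geodesic from `p` to an event `γ s` of the particle,
the parallel field `W` along it transports the 4-velocity `u'` of the particle at `γ s` to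
`W 0` at `p`, and `w = W 0 / (-g(W 0, u)) - u`. -/
def IsKinematicVelocity (a : ℝ → ℝ) (γ : ℝ → Coord) (τ : ℝ) (w : Coord) : Prop :=
  ∃ (s ρ : ℝ) (u' : Coord) (ψ V W : ℝ → Coord),
    IsFermiGeodesic a τ ρ ψ V ∧ ψ ρ = γ s ∧ HasDerivAt γ u' s ∧
    IsParallelAlong (metric a) ρ ψ V W ∧ W ρ = u' ∧
    w = (1 / (-scalarProd (metric a) (observer τ) (W 0) observerVelocity)) • W 0 - observerVelocity

/-- `w` is the Fermi relative velocity, measured at `(τ, 0)`, of the test particle with world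
line `γ`: if `(T s, R s)` are the Fermi coordinates of `γ s`, then
`w = (dR/ds) / (dT/ds) • (1/a(τ)) ∂/∂χ`, at the parameter where `T = τ`. -/
def IsFermiVelocity (a : ℝ → ℝ) (γ : ℝ → Coord) (τ : ℝ) (w : Coord) : Prop :=
  ∃ (s T' R' : ℝ) (T R : ℝ → ℝ),
    (∀ᶠ r in 𝓝 s, HasFermiCoordinates a (γ r) (T r) (R r)) ∧ T s = τ ∧
    HasDerivAt T T' s ∧ HasDerivAt R R' s ∧ T' ≠ 0 ∧ w = (R' / T') • radialUnit a τ

/-- The kinematic relative velocity (meaningful when there is exactly one). -/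
def kinematicVelocity (a : ℝ → ℝ) (γ : ℝ → Coord) (τ : ℝ) : Coord :=
  Classical.epsilon (IsKinematicVelocity a γ τ)

/-- The Fermi relative velocity (meaningful when there is exactly one). -/
def fermiVelocity (a : ℝ → ℝ) (γ : ℝ → Coord) (τ : ℝ) : Coord :=
  Classical.epsilon (IsFermiVelocity a γ τ)

/-- The norm `√g(w, w)` of a spacelike tangent vector at `(τ, 0)`. -/
def speed (a : ℝ → ℝ) (τ : ℝ) (w : Coord) : ℝ := √(scalarProd (metric a) (observer τ) w w)

/-- The proper lengths of the geodesic arcs in the Fermi space slice of `(τ, 0)`. -/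
def sliceLengths (a : ℝ → ℝ) (τ : ℝ) : Set ℝ :=
  {ρ | ∃ ψ V : ℝ → Coord, IsFermiGeodesic a τ ρ ψ V}

/-- The proper radius of the Fermi space slice of `(τ, 0)`. -/
def sliceRadius (a : ℝ → ℝ) (τ : ℝ) : ℝ := ∫ t in (0 : ℝ)..τ, a t / √(a τ ^ 2 - a t ^ 2)

/-- The power law scale factor `a(t) = t^α`. -/
def powerLaw (α : ℝ) : ℝ → ℝ := fun t => t ^ α

/-- The Hubble speed `v = α χ τ^(α - 1)`. -/
def hubbleSpeed (α τ χ : ℝ) : ℝ := α * χ * τ ^ (α - 1)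

/-- The constant `C_α`. -/
def constC (α : ℝ) : ℝ :=
  √Real.pi * Real.Gamma ((1 + α) / (2 * α)) / Real.Gamma (1 / (2 * α))

/-- The function `F_α`, to be used on `0 < z < 1`. -/
def funF (α z : ℝ) : ℝ :=
  z ^ ((1 - α) / α) *
    ordinaryHypergeometric (1 / 2 : ℝ) ((1 - α) / (2 * α)) ((1 + α) / (2 * α)) (z ^ 2)

/-- The function `G_α`; `F_α` is inverted on the interval `0 < z < 1`. -/
def funG (α v : ℝ) : ℝ :=
  (Function.invFunOn (funF α) (Ioo 0 1) (constC α + (α - 1) / α * v)) ^ (1 / α)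

/-- The bound `v_smax` of the Hubble speed. -/
def hubbleMax (α : ℝ) : EReal :=
  if α < 1 then ((α / (1 - α) * constC α : ℝ) : EReal) else ⊤

/-- The filter on pairs `(τ, χ)` with `τ > 0`, `χ > 0` that describes `v → v_smax` from below,
where `v` is the Hubble speed of the particle `χ` at the time `τ`. -/
def toHubbleMax (α : ℝ) : Filter (ℝ × ℝ) :=
  comap (fun p => (hubbleSpeed α p.1 p.2 : EReal)) (𝓝[<] hubbleMax α) ⊓
    𝓟 {p | 0 < p.1 ∧ 0 < p.2}

end RobertsonWalker

end

open RobertsonWalker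

/-! Along a geodesic from `(τ, 0)` orthogonal to `u`, the Killing field `∂/∂χ` gives `a(t)² χ' =
a(τ)`, and unit speed gives `t'² = a(τ)²/a(t)² - 1`. Put `cos θ = a(t)/a(τ)`. Then `t = τ cos^(1/α)
θ`, `t' = -tan θ` and `dθ/dr = α/t`, so the proper length is `τ L(θ)` with `L = arcLength α`, and `χ
= τ^(1-α)/α · X(θ)` with `X = hubbleOfAngle α`, `X' = cos^(1/α-2)`. Hence a comoving particle meets
the slice at the angle with `X(θ) = v` (`IsFermiGeodesic.exists_angle`; conversely,
`isFermiGeodesic_geodesicPoint` realizes every angle in `(0, π/2)`).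

Parallel transport preserves scalar products, so the transported 4-velocity has components `1/cos θ`
along `u` and `tan θ` along the unit normal: the kinematic speed is `sin θ`. Differentiating `ρ = τ
L(θ)` and `X(θ) = α χ τ^(α-1)` in `τ` gives the Fermi speed `L(θ) + (α-1)/α · cos² θ · v`.

The special functions enter through `funF_cos`: `F_α(cos θ) = C_α + (α-1)/α · X(θ)`. It follows from
a first order differential equation for the hypergeometric factor and from `L(π/2) = C_α`, a Beta
integral. Thus `G_α(v) = cos^(1/α) θ`, and the formulas become identities in `θ`. Since `v → v_smax`
means `θ → π/2`, the limits are `sin(π/2) = 1` and `L(π/2) = C_α`. -/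

namespace RobertsonWalker

/-! ### Length and Hubble speed as functions of the angle -/

/-- The proper length, in units of `τ`, of the orthogonal geodesic of a power law spacetime from
`(τ, 0)` to the event at which the scale factor is `cos θ` times its value at `τ`. -/
noncomputable def arcLength (α θ : ℝ) : ℝ := 1 / α * ∫ x in (0 : ℝ)..θ, Real.cos x ^ (1 / α)

/-- The Hubble speed of the comoving particle that passes through the endpoint of that geodesic. -/
noncomputable def hubbleOfAngle (α θ : ℝ) : ℝ :=
  α / (α - 1) * (Real.cos θ ^ ((1 - α) / α) * Real.sin θ - arcLength α θ)

variable {α τ ρ θ χ : ℝ}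

lemma continuous_cos_rpow (hα : 0 < α) : Continuous fun x => Real.cos x ^ (1 / α) :=
  Real.continuous_cos.rpow_const fun _ => Or.inr (by positivity)

lemma hasStrictDerivAt_arcLength (hα : 0 < α) (θ : ℝ) :
    HasStrictDerivAt (arcLength α) (1 / α * Real.cos θ ^ (1 / α)) θ :=
  (intervalIntegral.integral_hasStrictDerivAt_right
    ((continuous_cos_rpow hα).intervalIntegrable _ _)
    ((continuous_cos_rpow hα).stronglyMeasurableAtFilter _ _)
    (continuous_cos_rpow hα).continuousAt).const_mul _

lemma continuous_arcLength (hα : 0 < α) : Continuous (arcLength α) :=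
  continuous_iff_continuousAt.2 fun θ => (hasStrictDerivAt_arcLength hα θ).hasDerivAt.continuousAt

@[simp]
lemma arcLength_zero : arcLength α 0 = 0 := by simp [arcLength]

lemma cos_pos_of_mem (h : θ ∈ Ioo (-(Real.pi / 2)) (Real.pi / 2)) : 0 < Real.cos θ :=
  Real.cos_pos_of_mem_Ioo h

lemma Ioo_zero_subset : Ioo 0 (Real.pi / 2) ⊆ Ioo (-(Real.pi / 2)) (Real.pi / 2) :=
  Ioo_subset_Ioo_left (by linarith [Real.pi_pos])

lemma strictMonoOn_arcLength (hα : 0 < α) :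
    StrictMonoOn (arcLength α) (Icc (-(Real.pi / 2)) (Real.pi / 2)) := by
  refine strictMonoOn_of_deriv_pos (convex_Icc _ _) (continuous_arcLength hα).continuousOn ?_
  intro x hx
  rw [interior_Icc] at hx
  rw [(hasStrictDerivAt_arcLength hα x).hasDerivAt.deriv]
  have := cos_pos_of_mem hx
  positivity

lemma arcLength_pos (hα : 0 < α) (h : θ ∈ Ioo 0 (Real.pi / 2)) : 0 < arcLength α θ := by
  have := strictMonoOn_arcLength hα (a := 0) (b := θ)
    ⟨by linarith [Real.pi_pos], by linarith [Real.pi_pos]⟩ ⟨by linarith [Real.pi_pos, h.1], h.2.le⟩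
    h.1
  simpa using this

/-- The closed form is an integration by parts: after `sin² = 1 - cos²`, the `cos²` terms cancel
against the derivative of `arcLength`. Strictness serves the inverse function theorem later. -/
lemma hasStrictDerivAt_hubbleOfAngle (hα : 0 < α) (hα1 : α ≠ 1)
    (h : θ ∈ Ioo (-(Real.pi / 2)) (Real.pi / 2)) :
    HasStrictDerivAt (hubbleOfAngle α) (Real.cos θ ^ (1 / α - 2)) θ := by
  have hc := cos_pos_of_mem h
  have h1 : α - 1 ≠ 0 := sub_ne_zero.2 hα1
  have e := (((Real.hasStrictDerivAt_rpow_const (p := (1 - α) / α) (Or.inl hc.ne')).comp θ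
    (Real.hasStrictDerivAt_cos θ)).mul
    (Real.hasStrictDerivAt_sin θ)).sub (hasStrictDerivAt_arcLength hα θ) |>.const_mul (α / (α - 1))
  refine e.congr_deriv ?_
  have e1 : Real.cos θ ^ ((1 - α) / α) = Real.cos θ ^ (1 / α - 2) * Real.cos θ := by
    rw [← Real.rpow_add_one hc.ne']; congr 1; field_simp; ring
  have e2 : Real.cos θ ^ ((1 - α) / α - 1) = Real.cos θ ^ (1 / α - 2) := by
    congr 1; field_simp; ring
  have e3 : Real.cos θ ^ (1 / α) = Real.cos θ ^ (1 / α - 2) * Real.cos θ ^ 2 := by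
    rw [← Real.rpow_add_natCast hc.ne']; congr 1; push_cast; ring
  simp only [Function.comp_apply]
  rw [e1, e2, e3]
  field_simp
  rw [Real.sin_sq]
  ring

lemma hasDerivAt_hubbleOfAngle (hα : 0 < α) (hα1 : α ≠ 1)
    (h : θ ∈ Ioo (-(Real.pi / 2)) (Real.pi / 2)) :
    HasDerivAt (hubbleOfAngle α) (Real.cos θ ^ (1 / α - 2)) θ :=
  (hasStrictDerivAt_hubbleOfAngle hα hα1 h).hasDerivAt

lemma continuousOn_hubbleOfAngle (hα : 0 < α) (hα1 : α ≠ 1) :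
    ContinuousOn (hubbleOfAngle α) (Ioo (-(Real.pi / 2)) (Real.pi / 2)) :=
  fun _ hx => (hasDerivAt_hubbleOfAngle hα hα1 hx).continuousAt.continuousWithinAt

lemma strictMonoOn_hubbleOfAngle (hα : 0 < α) (hα1 : α ≠ 1) :
    StrictMonoOn (hubbleOfAngle α) (Ioo (-(Real.pi / 2)) (Real.pi / 2)) := by
  refine strictMonoOn_of_deriv_pos (convex_Ioo _ _) (continuousOn_hubbleOfAngle hα hα1) ?_
  intro x hx
  rw [interior_Ioo] at hx
  rw [(hasDerivAt_hubbleOfAngle hα hα1 hx).deriv]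
  exact Real.rpow_pos_of_pos (cos_pos_of_mem hx) _

@[simp]
lemma hubbleOfAngle_zero : hubbleOfAngle α 0 = 0 := by simp [hubbleOfAngle]

lemma hubbleOfAngle_pos (hα : 0 < α) (hα1 : α ≠ 1) (h : θ ∈ Ioo 0 (Real.pi / 2)) :
    0 < hubbleOfAngle α θ := by
  have := strictMonoOn_hubbleOfAngle hα hα1 (a := 0) (b := θ)
    ⟨by linarith [Real.pi_pos], by linarith [Real.pi_pos]⟩ (Ioo_zero_subset h) h.1
  simpa using this

/-- The defining relation of `hubbleOfAngle`, solved for the length. -/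
lemma arcLength_eq (hα : 0 < α) (hα1 : α ≠ 1) (θ : ℝ) :
    arcLength α θ = Real.cos θ ^ ((1 - α) / α) * Real.sin θ
      - (α - 1) / α * hubbleOfAngle α θ := by
  have h1 : α - 1 ≠ 0 := sub_ne_zero.2 hα1
  rw [hubbleOfAngle]; field_simp; ring

/-! ### The constant `C_α` as a Beta integral -/

lemma integral_beta (hα : 0 < α) :
    ∫ s in (0 : ℝ)..1, s ^ ((1 + α) / (2 * α) - 1) * (1 - s) ^ ((1 / 2 : ℝ) - 1)
      = 2 * α * constC α := by
  have hb := ProbabilityTheory.beta_eq_betaIntegralReal ((1 + α) / (2 * α)) (1 / 2)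
    (by positivity) (by norm_num)
  have e : Complex.betaIntegral ((1 + α) / (2 * α) : ℝ) (1 / 2 : ℝ) =
      ((∫ s in (0 : ℝ)..1, s ^ ((1 + α) / (2 * α) - 1) * (1 - s) ^ ((1 / 2 : ℝ) - 1) : ℝ) : ℂ) := by
    rw [Complex.betaIntegral, ← intervalIntegral.integral_ofReal]
    refine intervalIntegral.integral_congr fun x hx => ?_
    rw [uIcc_of_le zero_le_one] at hx
    rw [Complex.ofReal_mul, Complex.ofReal_cpow hx.1, Complex.ofReal_cpow (by linarith [hx.2])]
    push_cast
    rfl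
  rw [e, Complex.ofReal_re] at hb
  rw [← hb, ProbabilityTheory.beta, constC, Real.Gamma_one_half_eq,
    show (1 + α) / (2 * α) + 1 / 2 = 1 / (2 * α) + 1 by field_simp; ring,
    Real.Gamma_add_one (by positivity)]
  have := (Real.Gamma_pos_of_pos (s := 1 / (2 * α)) (by positivity)).ne'
  field_simp

lemma hasDerivAt_arcLength_arccos (hα : 0 < α) {z : ℝ} (hz : z ∈ Ioo (0 : ℝ) 1) :
    HasDerivAt (fun z => arcLength α (Real.arccos z)) (-(1 / α * z ^ (1 / α) / √(1 - z ^ 2))) z := by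
  have := (hasStrictDerivAt_arcLength hα (Real.arccos z)).hasDerivAt.comp z
    (Real.hasDerivAt_arccos (by linarith [hz.1]) (by linarith [hz.2]))
  rw [Real.cos_arccos (by linarith [hz.1]) hz.2.le] at this
  refine this.congr_deriv ?_
  ring

/-- The substitution `s = cos² θ` turns the length integral into the Beta integral. The integrand is
unbounded at `s = 1`; its integrability comes from its sign and the continuity of the primitive on
`[0, 1]`. -/
lemma arcLength_pi_div_two (hα : 0 < α) : arcLength α (Real.pi / 2) = constC α := by
  have hd : ∀ s ∈ Ioo (0 : ℝ) 1, HasDerivAt (fun s => -(2 * α) * arcLength α (Real.arccos √s))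
      (s ^ ((1 + α) / (2 * α) - 1) * (1 - s) ^ ((1 / 2 : ℝ) - 1)) s := by
    intro s hs
    have hs0 : 0 < √s := Real.sqrt_pos.2 hs.1
    have h1 : √s ∈ Ioo (0 : ℝ) 1 := ⟨hs0, by rw [Real.sqrt_lt' one_pos]; simpa using hs.2⟩
    refine (((hasDerivAt_arcLength_arccos hα h1).comp s
      (Real.hasDerivAt_sqrt hs.1.ne')).const_mul (-(2 * α))).congr_deriv ?_
    rw [Real.sq_sqrt hs.1.le, Real.sqrt_eq_rpow s, ← Real.rpow_mul hs.1.le,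
      show (1 + α) / (2 * α) - 1 = 1 / 2 * (1 / α) - 1 / 2 by field_simp; ring,
      Real.rpow_sub hs.1, show (1 / 2 : ℝ) - 1 = -(1 / 2) by norm_num,
      Real.rpow_neg (by linarith [hs.2]), ← Real.sqrt_eq_rpow (1 - s)]
    have : 0 < √(1 - s) := Real.sqrt_pos.2 (by linarith [hs.2])
    have := Real.rpow_pos_of_pos hs.1 (1 / 2 : ℝ)
    field_simp
  have hc : Continuous (fun s => -(2 * α) * arcLength α (Real.arccos √s)) :=
    continuous_const.mul ((continuous_arcLength hα).comp
      (Real.continuous_arccos.comp Real.continuous_sqrt))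
  have hi := intervalIntegral.integral_eq_sub_of_hasDerivAt_of_le zero_le_one hc.continuousOn hd
    (intervalIntegral.intervalIntegrable_deriv_of_nonneg hc.continuousOn (by simpa using hd)
      fun s hs => by
        simp only [zero_le_one, min_eq_left, max_eq_right] at hs
        have := hs.1
        have : 0 < 1 - s := by linarith [hs.2]
        positivity)
  rw [integral_beta hα] at hi
  simp only [Real.sqrt_one, Real.arccos_one, arcLength_zero, Real.sqrt_zero, Real.arccos_zero] at hi
  have : 2 * α ≠ 0 := by positivity
  apply mul_left_cancel₀ this
  linarith

lemma arcLength_lt_constC (hα : 0 < α) (h : θ ∈ Ioo 0 (Real.pi / 2)) :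
    arcLength α θ < constC α := by
  rw [← arcLength_pi_div_two hα]
  exact strictMonoOn_arcLength hα ⟨by linarith [h.1, Real.pi_pos], h.2.le⟩
    ⟨by linarith [Real.pi_pos], le_rfl⟩ h.2

/-! ### The hypergeometric function and `F_α` -/

/-- The Taylor coefficients of `(1 - x) ^ (-1 / 2)`. -/
noncomputable def invSqrtCoeff (n : ℕ) : ℝ :=
  (n.factorial : ℝ)⁻¹ * (ascPochhammer ℝ n).eval (1 / 2)

lemma invSqrtCoeff_pos (n : ℕ) : 0 < invSqrtCoeff n :=
  mul_pos (by positivity) (ascPochhammer_pos n _ (by norm_num))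

lemma hasSum_invSqrtCoeff {x : ℝ} (hx : |x| < 1) :
    HasSum (fun n => invSqrtCoeff n * x ^ n) (1 / √(1 - x)) := by
  have hx' : -x ∈ Metric.eball (0 : ℝ) 1 := by
    rw [← ENNReal.ofReal_one, Metric.eball_ofReal]; simpa using hx
  have h := (Real.one_add_rpow_hasFPowerSeriesOnBall_zero (a := -(1 / 2))).hasSum hx'
  -- The value `b = 1` is a dummy: the parameter occurs above and below, and its Pochhammer symbols
  -- cancel.
  rw [binomialSeries_eq_ordinaryHypergeometricSeries (b := (1 : ℝ))
    (fun k => by have : (0 : ℝ) ≤ k := k.cast_nonneg; linarith)] at h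
  have h1 : 0 < 1 - x := by linarith [(abs_lt.1 hx).2]
  have e : (1 + (0 + -x)) ^ (-(1 / 2) : ℝ) = 1 / √(1 - x) := by
    rw [zero_add, ← sub_eq_add_neg, Real.rpow_neg h1.le, Real.sqrt_eq_rpow, ← one_div]
  rw [e] at h
  refine h.congr_fun ?_
  intro n
  have hn : (ascPochhammer ℝ n).eval 1 ≠ 0 := (ascPochhammer_pos n _ one_pos).ne'
  rw [FormalMultilinearSeries.compContinuousLinearMap_apply,
    show (⇑(-ContinuousLinearMap.id ℝ ℝ) ∘ fun _ : Fin n => -x) = fun _ => x by ext; simp,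
    ordinaryHypergeometricSeries_apply_eq, mul_inv_cancel_right₀ hn, neg_neg]
  rfl

/-- The quotient of Pochhammer symbols `(b)_n / (b+1)_n` telescopes to `b / (b + n)`. -/
lemma ordinaryHypergeometric_add_one_right {b : ℝ} (hb : -(1 / 2) < b) (hb0 : b ≠ 0) (x : ℝ) :
    ordinaryHypergeometric (1 / 2 : ℝ) b (b + 1) x
      = ∑' n : ℕ, invSqrtCoeff n * (b / (b + n)) * x ^ n := by
  rw [ordinaryHypergeometric_eq_tsum]
  refine tsum_congr fun n => ?_
  have hn : b + n ≠ 0 := by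
    rcases n with _ | n
    · simpa using hb0
    · have : (0 : ℝ) ≤ n := n.cast_nonneg
      push_cast; linarith
  have hp : (ascPochhammer ℝ n).eval (b + 1) ≠ 0 := (ascPochhammer_pos n _ (by linarith)).ne'
  have h1 : (ascPochhammer ℝ n).eval b * (b + n) = b * (ascPochhammer ℝ n).eval (b + 1) := by
    rw [← ascPochhammer_succ_eval, ascPochhammer_succ_left]
    simp
  rw [smul_eq_mul, invSqrtCoeff, eq_div_iff_mul_eq hn |>.2 h1]
  field_simp

/-- The operator `x d/dx + b` multiplies `x^n` by `b + n`, which cancels the denominators and leaves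
the binomial series. -/
lemma hasDerivAt_ordinaryHypergeometric {b : ℝ} (hb : -(1 / 2) < b) (hb0 : b ≠ 0) {x : ℝ}
    (hx : |x| < 1) :
    ∃ h', HasDerivAt (ordinaryHypergeometric (1 / 2 : ℝ) b (b + 1)) h' x ∧
      x * h' + b * ordinaryHypergeometric (1 / 2 : ℝ) b (b + 1) x = b * (1 / √(1 - x)) := by
  obtain ⟨r, hxr, hr1⟩ := exists_between hx
  have hr0 : 0 < r := (abs_nonneg x).trans_lt hxr
  have hs := (hasSum_invSqrtCoeff (x := r) (by rwa [abs_of_pos hr0])).summable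
  -- This is where `b > -1/2` enters: it bounds `n / (b + n)` by `2`, so the differentiated series
  -- is dominated on the ball of radius `r`.
  have hbn : ∀ n : ℕ, 1 ≤ n → (n : ℝ) / 2 ≤ b + n := fun n hn => by
    have : (1 : ℝ) ≤ n := by exact_mod_cast hn
    linarith
  have hne : ∀ n : ℕ, b + n ≠ 0 := fun n => by
    rcases Nat.eq_zero_or_pos n with rfl | hn
    · simpa using hb0
    · have := hbn n hn
      have : (1 : ℝ) ≤ n := by exact_mod_cast hn
      linarith
  have hsum : Summable fun n : ℕ => invSqrtCoeff n * (b / (b + n)) * x ^ n := by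
    refine Summable.of_norm_bounded (hs.mul_left (2 * |b| + 1)) fun n => ?_
    have hp := invSqrtCoeff_pos n
    have hk : |b / (b + n)| ≤ 2 * |b| + 1 := by
      rcases Nat.eq_zero_or_pos n with rfl | hn
      · simp [hb0]
      · have h1 := hbn n hn
        have h2 : (1 : ℝ) ≤ n := by exact_mod_cast hn
        have h3 : 1 / 2 ≤ b + n := by linarith
        rw [abs_div, abs_of_pos (by linarith : 0 < b + n), div_le_iff₀ (by linarith)]
        nlinarith [abs_nonneg b]
    rw [Real.norm_eq_abs, abs_mul, abs_mul, abs_of_pos hp, abs_pow]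
    calc invSqrtCoeff n * |b / (b + n)| * |x| ^ n
        ≤ invSqrtCoeff n * (2 * |b| + 1) * r ^ n := by gcongr
      _ = _ := by ring
  have hd : HasDerivAt (fun z => ∑' n : ℕ, invSqrtCoeff n * (b / (b + n)) * z ^ n)
      (∑' n : ℕ, invSqrtCoeff n * (b / (b + n)) * (n * x ^ (n - 1))) x := by
    refine hasDerivAt_tsum_of_isPreconnected (u := fun n : ℕ => 2 * |b| / r * (invSqrtCoeff n * r ^ n))
      (t := Metric.ball 0 r) (hs.mul_left _) Metric.isOpen_ball
      (convex_ball _ _).isPreconnected (fun n y _ => (hasDerivAt_pow n y).const_mul _) ?_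
      (y₀ := x) (by simpa using hxr) hsum (by simpa using hxr)
    intro n y hy
    have hp := invSqrtCoeff_pos n
    have hy : |y| < r := by simpa using hy
    rcases Nat.eq_zero_or_pos n with rfl | hn
    · simp; positivity
    · have h1 := hbn n hn
      have h2 : (1 : ℝ) ≤ n := by exact_mod_cast hn
      have hk : |b / (b + n)| * n ≤ 2 * |b| := by
        rw [abs_div, abs_of_pos (by linarith : 0 < b + n), div_mul_eq_mul_div,
          div_le_iff₀ (by linarith)]
        nlinarith [abs_nonneg b]
      rw [Real.norm_eq_abs, abs_mul, abs_mul, abs_of_pos hp, abs_mul, abs_pow, Nat.abs_cast]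
      calc invSqrtCoeff n * |b / (b + n)| * (n * |y| ^ (n - 1))
          = invSqrtCoeff n * (|b / (b + n)| * n) * |y| ^ (n - 1) := by ring
        _ ≤ invSqrtCoeff n * (2 * |b|) * r ^ (n - 1) := by gcongr
        _ = _ := by
          obtain ⟨m, rfl⟩ : ∃ m, n = m + 1 := ⟨n - 1, by omega⟩
          rw [Nat.add_sub_cancel, pow_succ]; field_simp
  have hf : ordinaryHypergeometric (1 / 2 : ℝ) b (b + 1)
      = fun z => ∑' n : ℕ, invSqrtCoeff n * (b / (b + n)) * z ^ n :=
    funext (ordinaryHypergeometric_add_one_right hb hb0)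
  refine ⟨_, hf ▸ hd, ?_⟩
  rw [ordinaryHypergeometric_add_one_right hb hb0, ← (hasSum_invSqrtCoeff hx).tsum_eq,
    ← tsum_mul_left, ← tsum_mul_left, ← tsum_mul_left]
  have e : ∀ n : ℕ, x * (invSqrtCoeff n * (b / (b + n)) * (n * x ^ (n - 1)))
      = b * (invSqrtCoeff n * x ^ n) - b * (invSqrtCoeff n * (b / (b + n)) * x ^ n) := by
    intro n
    have := hne n
    rcases n with _ | n
    · field_simp; simp
    · rw [Nat.add_sub_cancel, pow_succ]
      field_simp; ring
  have hs1 := (hasSum_invSqrtCoeff hx).summable.mul_left b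
  rw [tsum_congr e, hs1.tsum_sub (hsum.mul_left b)]
  ring

lemma hyper_param_gt (hα : 0 < α) : -(1 / 2) < (1 - α) / (2 * α) := by
  rw [lt_div_iff₀ (by positivity)]; linarith

lemma hyper_param_ne (hα : 0 < α) (hα1 : α ≠ 1) : (1 - α) / (2 * α) ≠ 0 :=
  div_ne_zero (sub_ne_zero.2 hα1.symm) (by positivity)

lemma hyper_param_add_one (hα : 0 < α) : (1 - α) / (2 * α) + 1 = (1 + α) / (2 * α) := by
  field_simp; ring

lemma hasDerivAt_funF (hα : 0 < α) (hα1 : α ≠ 1) {z : ℝ} (hz : z ∈ Ioo (0 : ℝ) 1) :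
    HasDerivAt (funF α) ((1 - α) / α * z ^ ((1 - α) / α - 1) / √(1 - z ^ 2)) z := by
  have hz2 : |z ^ 2| < 1 := by
    rw [abs_of_nonneg (sq_nonneg z)]; nlinarith [hz.1, hz.2]
  obtain ⟨h', hd, he⟩ := hasDerivAt_ordinaryHypergeometric (hyper_param_gt hα)
    (hyper_param_ne hα hα1) hz2
  rw [hyper_param_add_one hα] at hd he
  have h2 := (Real.hasDerivAt_rpow_const (p := (1 - α) / α) (Or.inl hz.1.ne')).mul
    (HasDerivAt.comp (h := fun z : ℝ => z ^ 2) z hd (hasDerivAt_pow 2 z))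
  refine h2.congr_deriv ?_
  simp only [Function.comp_apply]
  have e1 : z ^ ((1 - α) / α) = z ^ ((1 - α) / α - 1) * z := by
    rw [← Real.rpow_add_one hz.1.ne']; congr 1; ring
  have e2 : (1 - α) / (2 * α) = (1 - α) / α / 2 := by field_simp
  rw [e1]
  push_cast
  set h := ordinaryHypergeometric (1 / 2 : ℝ) ((1 - α) / (2 * α)) ((1 + α) / (2 * α)) (z ^ 2)
  rw [e2] at he
  generalize z ^ ((1 - α) / α - 1) = q
  linear_combination (2 * q) * he

/-- For `α > 1` both terms blow up at `0`. The hypergeometric factor and the root are both `1` at `z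
= 0` and differentiable in `z²`, so the difference is `O(z^(1/α + 1))`. -/
lemma tendsto_funF_sub (hα : 0 < α) (hα1 : α ≠ 1) :
    Tendsto (fun z => funF α z - z ^ ((1 - α) / α) * √(1 - z ^ 2)) (𝓝[>] 0) (𝓝 0) := by
  obtain ⟨h', hd, -⟩ := hasDerivAt_ordinaryHypergeometric (hyper_param_gt hα)
    (hyper_param_ne hα hα1) (x := 0) (by simp)
  rw [hyper_param_add_one hα] at hd
  have hq : HasDerivAt (fun x : ℝ => √(1 - x)) (-1 / (2 * √(1 - 0))) 0 :=
    ((hasDerivAt_id (0 : ℝ)).const_sub 1).sqrt (by simp)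
  have hk := hasDerivAt_iff_tendsto_slope_zero.1 (hd.sub hq)
  simp only [zero_add, Pi.sub_apply, ordinaryHypergeometric_zero, sub_zero, Real.sqrt_one, sub_self,
    smul_eq_mul] at hk
  have hsq : Tendsto (fun z : ℝ => z ^ 2) (𝓝[>] 0) (𝓝[≠] 0) := by
    refine tendsto_nhdsWithin_iff.2 ⟨?_, ?_⟩
    · exact ((continuous_pow 2).tendsto' 0 0 (by simp)).mono_left nhdsWithin_le_nhds
    · filter_upwards [self_mem_nhdsWithin] with z hz
      exact pow_ne_zero 2 (ne_of_gt hz)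
  have hp : Tendsto (fun z : ℝ => z ^ (1 / α + 1)) (𝓝[>] 0) (𝓝 0) := by
    have : 1 / α + 1 ≠ 0 := by positivity
    have h := (Real.continuousAt_rpow_const 0 (1 / α + 1) (Or.inr (by positivity))).tendsto
    rw [Real.zero_rpow this] at h
    exact h.mono_left nhdsWithin_le_nhds
  have := hp.mul (hk.comp hsq)
  rw [zero_mul] at this
  refine this.congr' ?_
  filter_upwards [self_mem_nhdsWithin] with z hz
  have hz : 0 < z := hz
  simp only [Function.comp_apply, funF]
  rw [show 1 / α + 1 = (1 - α) / α + (2 : ℕ) by push_cast; field_simp; ring,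
    Real.rpow_add_natCast hz.ne']
  field_simp

/-- Both sides have the same derivative on `(0, 1)`; the limit at `z = 0`, where `arccos z` tends to
`π/2`, fixes the constant. -/
lemma funF_eq (hα : 0 < α) (hα1 : α ≠ 1) {z : ℝ} (hz : z ∈ Ioo (0 : ℝ) 1) :
    funF α z = constC α + z ^ ((1 - α) / α) * √(1 - z ^ 2) - arcLength α (Real.arccos z) := by
  set H : ℝ → ℝ := fun z => funF α z - z ^ ((1 - α) / α) * √(1 - z ^ 2)
    + arcLength α (Real.arccos z) with hH
  have hd : ∀ z ∈ Ioo (0 : ℝ) 1, HasDerivAt H 0 z := by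
    intro z hz
    have h1 : 0 < 1 - z ^ 2 := by nlinarith [hz.1, hz.2]
    have hs := Real.sqrt_pos.2 h1
    have h2 := ((hasDerivAt_pow 2 z).const_sub 1).sqrt h1.ne'
    have h3 := (Real.hasDerivAt_rpow_const (p := (1 - α) / α) (Or.inl hz.1.ne')).mul h2
    refine (((hasDerivAt_funF hα hα1 hz).sub h3).add
      (hasDerivAt_arcLength_arccos hα hz)).congr_deriv ?_
    have e1 : z ^ ((1 - α) / α) = z ^ ((1 - α) / α - 1) * z := by
      rw [← Real.rpow_add_one hz.1.ne']; congr 1; ring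
    have e2 : z ^ (1 / α) = z ^ ((1 - α) / α - 1) * z ^ 2 := by
      rw [← Real.rpow_add_natCast hz.1.ne']; congr 1; field_simp; push_cast; ring
    have e3 : 1 - z ^ 2 = √(1 - z ^ 2) ^ 2 := (Real.sq_sqrt h1.le).symm
    rw [e1, e2]
    push_cast
    field_simp
    rw [← e3]
    ring
  have hconst : ∀ y ∈ Ioo (0 : ℝ) 1, H y = H z := fun y hy =>
    isOpen_Ioo.is_const_of_deriv_eq_zero isPreconnected_Ioo
      (fun x hx => (hd x hx).differentiableAt.differentiableWithinAt)
      (fun x hx => (hd x hx).deriv) hy hz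
  have hl : Tendsto H (𝓝[>] 0) (𝓝 (0 + constC α)) := by
    refine (tendsto_funF_sub hα hα1).add ?_
    rw [← arcLength_pi_div_two hα, ← Real.arccos_zero]
    exact (((continuous_arcLength hα).comp Real.continuous_arccos).tendsto 0).mono_left
      nhdsWithin_le_nhds
  have hl' : Tendsto H (𝓝[>] 0) (𝓝 (H z)) := by
    refine tendsto_const_nhds.congr' ?_
    filter_upwards [Ioo_mem_nhdsGT one_pos] with y hy
    exact (hconst y hy).symm
  have := tendsto_nhds_unique hl hl'
  simp only [hH] at this
  linarith

lemma funF_cos (hα : 0 < α) (hα1 : α ≠ 1) (h : θ ∈ Ioo 0 (Real.pi / 2)) :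
    funF α (Real.cos θ) = constC α + (α - 1) / α * hubbleOfAngle α θ := by
  have hs : 0 < Real.sin θ := Real.sin_pos_of_pos_of_lt_pi h.1 (by linarith [h.2, Real.pi_pos])
  have hc := cos_pos_of_mem (Ioo_zero_subset h)
  have hc1 : Real.cos θ < 1 := by nlinarith [Real.sin_sq_add_cos_sq θ]
  rw [funF_eq hα hα1 ⟨hc, hc1⟩, Real.arccos_cos h.1.le (by linarith [h.2, Real.pi_pos]),
    ← Real.abs_sin_eq_sqrt_one_sub_cos_sq, abs_of_pos hs]
  linarith [arcLength_eq hα hα1 θ]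

/-- The angles in `(0, π / 2)` correspond to the cosines in `(0, 1)`. -/
lemma exists_cos_eq {z : ℝ} (hz : z ∈ Ioo (0 : ℝ) 1) :
    ∃ θ ∈ Ioo 0 (Real.pi / 2), Real.cos θ = z :=
  ⟨Real.arccos z, ⟨Real.arccos_pos.2 hz.2, Real.arccos_lt_pi_div_two.2 hz.1⟩,
    Real.cos_arccos (by linarith [hz.1]) hz.2.le⟩

lemma cos_mem_Ioo (h : θ ∈ Ioo 0 (Real.pi / 2)) : Real.cos θ ∈ Ioo (0 : ℝ) 1 := by
  have hs : 0 < Real.sin θ := Real.sin_pos_of_pos_of_lt_pi h.1 (by linarith [h.2, Real.pi_pos])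
  have hc := cos_pos_of_mem (Ioo_zero_subset h)
  exact ⟨hc, by nlinarith [Real.sin_sq_add_cos_sq θ]⟩

lemma funF_injOn (hα : 0 < α) (hα1 : α ≠ 1) : InjOn (funF α) (Ioo 0 1) := by
  intro y hy z hz h
  obtain ⟨θ, hθ, rfl⟩ := exists_cos_eq hy
  obtain ⟨φ, hφ, rfl⟩ := exists_cos_eq hz
  rw [funF_cos hα hα1 hθ, funF_cos hα hα1 hφ] at h
  have h2 : (α - 1) / α ≠ 0 := div_ne_zero (sub_ne_zero.2 hα1) hα.ne'
  rw [(strictMonoOn_hubbleOfAngle hα hα1).injOn (Ioo_zero_subset hθ) (Ioo_zero_subset hφ)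
    (mul_left_cancel₀ h2 (add_left_cancel h))]

lemma funG_hubbleOfAngle (hα : 0 < α) (hα1 : α ≠ 1) (h : θ ∈ Ioo 0 (Real.pi / 2)) :
    funG α (hubbleOfAngle α θ) = Real.cos θ ^ (1 / α) := by
  rw [funG, ← funF_cos hα hα1 h, (funF_injOn hα hα1).leftInvOn_invFunOn (cos_mem_Ioo h)]

/-! ### The range of the Hubble speed -/

/-- The Hubble speeds of the particles on a slice are all the positive ones below the bound. -/
lemma hubbleOfAngle_lt_hubbleMax (hα : 0 < α) (h : θ ∈ Ioo 0 (Real.pi / 2)) :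
    (hubbleOfAngle α θ : EReal) < hubbleMax α := by
  rw [hubbleMax]
  split_ifs with h1
  · rw [EReal.coe_lt_coe_iff]
    have hs : 0 < Real.sin θ := Real.sin_pos_of_pos_of_lt_pi h.1 (by linarith [h.2, Real.pi_pos])
    have hc := cos_pos_of_mem (Ioo_zero_subset h)
    have e : hubbleOfAngle α θ
        = α / (1 - α) * (arcLength α θ - Real.cos θ ^ ((1 - α) / α) * Real.sin θ) := by
      rw [hubbleOfAngle, ← neg_sub 1 α, div_neg]; ring
    rw [e]
    have : 0 < α / (1 - α) := div_pos hα (by linarith)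
    refine mul_lt_mul_of_pos_left ?_ this
    have := arcLength_lt_constC hα h
    have : 0 < Real.cos θ ^ ((1 - α) / α) * Real.sin θ := by positivity
    linarith
  · exact EReal.coe_lt_top _

lemma tendsto_cos_pi_div_two : Tendsto Real.cos (𝓝[<] (Real.pi / 2)) (𝓝[>] 0) := by
  refine tendsto_nhdsWithin_iff.2 ⟨?_, ?_⟩
  · exact (Real.continuous_cos.tendsto' _ _ Real.cos_pi_div_two).mono_left nhdsWithin_le_nhds
  · filter_upwards [Ioo_mem_nhdsLT (show -(Real.pi / 2) < Real.pi / 2 by linarith [Real.pi_pos])]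
      with x hx using cos_pos_of_mem hx

/-- As `θ → π/2`, the factor `cos^((1-α)/α) θ` tends to `0` for `α < 1` and to `∞` for `α > 1`,
which produces the two cases of `hubbleMax`. -/
lemma exists_hubbleOfAngle_gt (hα : 0 < α) (hα1 : α ≠ 1) {v : ℝ}
    (hv : (v : EReal) < hubbleMax α) :
    ∃ θ ∈ Ioo 0 (Real.pi / 2), v < hubbleOfAngle α θ := by
  have hpi : (0 : ℝ) < Real.pi / 2 := by linarith [Real.pi_pos]
  have hsin : Tendsto Real.sin (𝓝[<] (Real.pi / 2)) (𝓝 1) :=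
    (Real.continuous_sin.tendsto' _ _ Real.sin_pi_div_two).mono_left nhdsWithin_le_nhds
  have harc : Tendsto (arcLength α) (𝓝[<] (Real.pi / 2)) (𝓝 (constC α)) :=
    ((continuous_arcLength hα).tendsto' _ _ (arcLength_pi_div_two hα)).mono_left nhdsWithin_le_nhds
  suffices hev : ∀ᶠ θ in 𝓝[<] (Real.pi / 2), v < hubbleOfAngle α θ from
    (Filter.Eventually.and (Ioo_mem_nhdsLT hpi) hev).exists
  rw [hubbleMax] at hv
  split_ifs at hv with h1
  · rw [EReal.coe_lt_coe_iff] at hv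
    have hp : 0 < (1 - α) / α := div_pos (by linarith) hα
    have hc : Tendsto (fun θ => Real.cos θ ^ ((1 - α) / α)) (𝓝[<] (Real.pi / 2)) (𝓝 0) := by
      have := (Real.continuousAt_rpow_const 0 ((1 - α) / α) (Or.inr hp.le)).tendsto
      rw [Real.zero_rpow hp.ne'] at this
      exact this.comp (tendsto_cos_pi_div_two.mono_right nhdsWithin_le_nhds)
    have := ((hc.mul hsin).sub harc).const_mul (α / (α - 1))
    refine this.eventually_const_lt (lt_of_lt_of_eq hv ?_)
    rw [← neg_sub 1 α, div_neg]; ring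
  · have h1 : 1 < α := lt_of_le_of_ne (not_lt.1 h1) hα1.symm
    have hc : Tendsto (fun θ => Real.cos θ ^ ((1 - α) / α)) (𝓝[<] (Real.pi / 2)) atTop :=
      (tendsto_rpow_neg_nhdsGT_zero (div_neg_of_neg_of_pos (by linarith) hα)).comp
        tendsto_cos_pi_div_two
    have h2 := (tendsto_atTop_add_right_of_le' _ (-(constC α)) (hc.atTop_mul_pos one_pos hsin)
      (g := fun θ => -arcLength α θ) (by
        filter_upwards [Ioo_mem_nhdsLT hpi] with θ hθ
        linarith [arcLength_lt_constC hα hθ])).const_mul_atTop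
          (show 0 < α / (α - 1) from div_pos hα (by linarith))
    exact h2.eventually_gt_atTop v

lemma exists_hubbleOfAngle_eq (hα : 0 < α) (hα1 : α ≠ 1) {v : ℝ} (hv0 : 0 < v)
    (hv : (v : EReal) < hubbleMax α) :
    ∃ θ ∈ Ioo 0 (Real.pi / 2), hubbleOfAngle α θ = v := by
  obtain ⟨φ, hφ, hlt⟩ := exists_hubbleOfAngle_gt hα hα1 hv
  have hsub : Icc 0 φ ⊆ Ioo (-(Real.pi / 2)) (Real.pi / 2) := fun x hx =>
    ⟨by linarith [hx.1, Real.pi_pos], hx.2.trans_lt hφ.2⟩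
  obtain ⟨θ, hθ, e⟩ := intermediate_value_Ioo hφ.1.le
    ((continuousOn_hubbleOfAngle hα hα1).mono hsub) ⟨by simpa using hv0, hlt⟩
  exact ⟨θ, ⟨hθ.1, hθ.2.trans hφ.2⟩, e⟩

/-! ### Christoffel symbols, parallel transport and conservation laws -/

variable {ψ V W U : ℝ → Coord}

lemma scalarProd_metric (a : ℝ → ℝ) (x v w : Coord) :
    scalarProd (metric a) x v w = -(v 0 * w 0) + a (x 0) ^ 2 * (v 1 * w 1) := by
  simp [scalarProd, metric, Matrix.mulVec, dotProduct, Fin.sum_univ_two]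
  ring

lemma pderiv_const (i : Fin 2) (c : ℝ) (x : Coord) : pderiv i (fun _ => c) x = 0 := by
  simp [pderiv]

lemma hasFDerivAt_powerLaw_sq {x : Coord} (hx : 0 < x 0) :
    HasFDerivAt (fun y : Coord => powerLaw α (y 0) ^ 2)
      ((2 * (α / x 0) * powerLaw α (x 0) ^ 2) • ContinuousLinearMap.proj (R := ℝ) 0) x := by
  have h0 : HasFDerivAt (fun y : Coord => y 0) (ContinuousLinearMap.proj (R := ℝ) 0) x :=
    hasFDerivAt_apply 0 x
  have h1 := ((Real.hasDerivAt_rpow_const (p := α) (Or.inl hx.ne')).pow 2).comp_hasFDerivAt x h0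
  refine h1.congr_fderiv ?_
  congr 1
  rw [Real.rpow_sub_one hx.ne', powerLaw]
  push_cast
  field_simp

lemma pderiv_zero_powerLaw_sq {x : Coord} (hx : 0 < x 0) :
    pderiv 0 (fun y => powerLaw α (y 0) ^ 2) x = 2 * (α / x 0) * powerLaw α (x 0) ^ 2 := by
  rw [pderiv, (hasFDerivAt_powerLaw_sq hx).fderiv]; simp

lemma pderiv_one_powerLaw_sq {x : Coord} (hx : 0 < x 0) :
    pderiv 1 (fun y => powerLaw α (y 0) ^ 2) x = 0 := by
  rw [pderiv, (hasFDerivAt_powerLaw_sq hx).fderiv]; simp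

lemma powerLaw_pos {t : ℝ} (ht : 0 < t) : 0 < powerLaw α t := Real.rpow_pos_of_pos ht α

lemma metric_inv {x : Coord} (hx : 0 < x 0) :
    (metric (powerLaw α) x)⁻¹ = !![-1, 0; 0, (powerLaw α (x 0) ^ 2)⁻¹] := by
  have := (powerLaw_pos (α := α) hx).ne'
  refine Matrix.inv_eq_right_inv ?_
  ext i j
  fin_cases i <;> fin_cases j <;> simp [metric, this]

/-- The quadratic form of the Christoffel symbols of a power law spacetime. -/
lemma sum_christoffel {x : Coord} (hx : 0 < x 0) (v w : Coord) :
    (fun k => -∑ i, ∑ j, christoffel (metric (powerLaw α)) x k i j * v i * w j)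
      = ![-(α / x 0 * powerLaw α (x 0) ^ 2 * (v 1 * w 1)),
          -(α / x 0 * (v 0 * w 1 + v 1 * w 0))] := by
  have := (powerLaw_pos (α := α) hx).ne'
  have e : ∀ y : Coord, metric (powerLaw α) y = !![-1, 0; 0, powerLaw α (y 0) ^ 2] := fun _ => rfl
  ext k
  fin_cases k
  · simp only [christoffel, metric_inv hx, Fin.sum_univ_two]
    simp only [e]
    simp [pderiv_const, pderiv_zero_powerLaw_sq hx, pderiv_one_powerLaw_sq hx]
    ring
  · simp only [christoffel, metric_inv hx, Fin.sum_univ_two]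
    simp only [e]
    simp [pderiv_const, pderiv_zero_powerLaw_sq hx, pderiv_one_powerLaw_sq hx]
    field_simp
    ring

/-- Parallel transport in components. -/
lemma isParallelAlong_iff (ht : ∀ r ∈ Icc 0 ρ, 0 < ψ r 0) :
    IsParallelAlong (metric (powerLaw α)) ρ ψ V W ↔ ∀ r ∈ Icc 0 ρ,
      HasDerivWithinAt (fun r => W r 0)
        (-(α / ψ r 0 * powerLaw α (ψ r 0) ^ 2 * (V r 1 * W r 1))) (Icc 0 ρ) r ∧
      HasDerivWithinAt (fun r => W r 1)
        (-(α / ψ r 0 * (V r 0 * W r 1 + V r 1 * W r 0))) (Icc 0 ρ) r := by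
  refine forall₂_congr fun r hr => ?_
  rw [sum_christoffel (ht r hr), hasDerivWithinAt_pi, Fin.forall_fin_two]
  rfl

lemma eq_left_of_hasDerivWithinAt_zero {f : ℝ → ℝ} {b : ℝ}
    (hf : ∀ x ∈ Icc 0 b, HasDerivWithinAt f 0 (Icc 0 b) x) : ∀ x ∈ Icc 0 b, f x = f 0 := by
  intro x hx
  rcases hx.1.eq_or_lt with rfl | hx0
  · rfl
  have hu := uniqueDiffOn_Icc (hx0.trans_le hx.2)
  exact constant_of_derivWithin_zero (fun y hy => (hf y hy).differentiableWithinAt)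
    (fun y hy => (hf y ⟨hy.1, hy.2.le⟩).derivWithin (hu y ⟨hy.1, hy.2.le⟩)) x hx

lemma hasDerivWithinAt_powerLaw_sq {s : Set ℝ} {r : ℝ} (hψ : HasDerivWithinAt ψ (V r) s r)
    (ht : 0 < ψ r 0) :
    HasDerivWithinAt (fun r => powerLaw α (ψ r 0) ^ 2)
      (2 * (α / ψ r 0) * powerLaw α (ψ r 0) ^ 2 * V r 0) s r := by
  have := (hasFDerivAt_powerLaw_sq (α := α) ht).comp_hasDerivWithinAt r hψ
  refine this.congr_deriv ?_
  simp

/-- Parallel transport preserves the scalar product. -/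
lemma scalarProd_eq_of_isParallelAlong (ht : ∀ r ∈ Icc 0 ρ, 0 < ψ r 0)
    (hψ : ∀ r ∈ Icc 0 ρ, HasDerivWithinAt ψ (V r) (Icc 0 ρ) r)
    (hW : IsParallelAlong (metric (powerLaw α)) ρ ψ V W)
    (hU : IsParallelAlong (metric (powerLaw α)) ρ ψ V U) {r : ℝ} (hr : r ∈ Icc 0 ρ) :
    -(W r 0 * U r 0) + powerLaw α (ψ r 0) ^ 2 * (W r 1 * U r 1)
      = -(W 0 0 * U 0 0) + powerLaw α (ψ 0 0) ^ 2 * (W 0 1 * U 0 1) := by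
  rw [isParallelAlong_iff ht] at hW hU
  refine eq_left_of_hasDerivWithinAt_zero (f := fun r => -(W r 0 * U r 0)
    + powerLaw α (ψ r 0) ^ 2 * (W r 1 * U r 1)) (fun x hx => ?_) r hr
  have h1 := (((hW x hx).1.mul (hU x hx).1).neg).add
    ((hasDerivWithinAt_powerLaw_sq (α := α) (hψ x hx) (ht x hx)).mul
      ((hW x hx).2.mul (hU x hx).2))
  refine h1.congr_deriv ?_
  simp only [Pi.mul_apply]
  ring

/-- Conservation of the momentum that belongs to the Killing field `∂/∂χ`. -/
lemma momentum_eq_of_geodesic (ht : ∀ r ∈ Icc 0 ρ, 0 < ψ r 0)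
    (hψ : ∀ r ∈ Icc 0 ρ, HasDerivWithinAt ψ (V r) (Icc 0 ρ) r)
    (hV : IsParallelAlong (metric (powerLaw α)) ρ ψ V V) {r : ℝ} (hr : r ∈ Icc 0 ρ) :
    powerLaw α (ψ r 0) ^ 2 * V r 1 = powerLaw α (ψ 0 0) ^ 2 * V 0 1 := by
  rw [isParallelAlong_iff ht] at hV
  refine eq_left_of_hasDerivWithinAt_zero
    (f := fun r => powerLaw α (ψ r 0) ^ 2 * V r 1) (fun x hx => ?_) r hr
  have h1 := (hasDerivWithinAt_powerLaw_sq (α := α) (hψ x hx) (ht x hx)).mul (hV x hx).2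
  refine h1.congr_deriv ?_
  ring

/-! ### Every orthogonal geodesic is described by an angle -/

/-- Only interior derivatives are assumed, because the angle is an `arccos` whose argument is `1` at
the start of the geodesic. -/
lemma eq_of_hasDerivAt_zero {f : ℝ → ℝ} {b : ℝ} (hb : 0 < b) (hc : ContinuousOn f (Icc 0 b))
    (hf : ∀ x ∈ Ioo 0 b, HasDerivAt f 0 x) : f b = f 0 := by
  obtain ⟨c, -, h⟩ := exists_hasDerivAt_eq_slope f (fun _ => 0) hb hc hf
  have : b - 0 ≠ 0 := by simpa using hb.ne'
  field_simp at h
  linarith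

/-- The endpoint of an orthogonal geodesic of a power law spacetime. -/
lemma IsFermiGeodesic.exists_angle (hα : 0 < α) (hα1 : α ≠ 1)
    (h : IsFermiGeodesic (powerLaw α) τ ρ ψ V) :
    ∃ θ ∈ Ioo 0 (Real.pi / 2), ρ = τ * arcLength α θ ∧
      ψ ρ = ![τ * Real.cos θ ^ (1 / α), τ ^ (1 - α) / α * hubbleOfAngle α θ] ∧
      V ρ 0 = -Real.tan θ ∧ V 0 0 = 0 ∧ V 0 1 = 1 / τ ^ α := by
  have hτ := h.tau_pos
  have hρ := h.rho_pos
  have ht := h.time_pos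
  have hv := h.velocity
  have hg := h.geodesic
  have hV00 : V 0 0 = 0 := by
    have := h.orthogonal
    rw [scalarProd_metric] at this
    simpa [observerVelocity] using this
  have ha0 : 0 < τ ^ α := Real.rpow_pos_of_pos hτ α
  have hV01 : V 0 1 = 1 / τ ^ α := by
    have h1 := h.unit
    rw [scalarProd_metric, hV00] at h1
    simp only [observer, powerLaw, Matrix.cons_val_zero] at h1
    have h2 := h.outward
    rw [eq_div_iff ha0.ne']
    have h3 : (V 0 1 * τ ^ α) ^ 2 = 1 ^ 2 := by linear_combination h1
    exact (pow_left_inj₀ (by positivity) zero_le_one two_ne_zero).1 h3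
  have h0 : ψ 0 0 = τ := by rw [h.start]; simp [observer]
  have h01 : ψ 0 1 = 0 := by rw [h.start]; simp [observer]
  have hK : ∀ r ∈ Icc 0 ρ, (ψ r 0 ^ α) ^ 2 * V r 1 = τ ^ α := fun r hr => by
    have := momentum_eq_of_geodesic ht hv hg hr
    rw [h0, hV01] at this
    simp only [powerLaw] at this
    rw [this]; field_simp
  have hN : ∀ r ∈ Icc 0 ρ, -(V r 0 * V r 0) + (ψ r 0 ^ α) ^ 2 * (V r 1 * V r 1) = 1 :=
    fun r hr => by
      have := scalarProd_eq_of_isParallelAlong ht hv hg hg hr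
      rw [h0, hV01, hV00] at this
      simp only [powerLaw] at this
      rw [this]; field_simp; ring
  have hpow : ∀ r ∈ Icc 0 ρ, 0 < ψ r 0 ^ α := fun r hr => Real.rpow_pos_of_pos (ht r hr) α
  have hcψ : ContinuousOn ψ (Icc 0 ρ) := fun r hr => (hv r hr).continuousWithinAt
  have hcψi : ∀ i, ContinuousOn (fun r => ψ r i) (Icc 0 ρ) := fun i =>
    (continuous_apply i).comp_continuousOn hcψ
  have hg' := (isParallelAlong_iff ht).1 hg
  -- The normalization determines `V r 0` only up to sign. The geodesic equation makes it strictly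
  -- decreasing from `0`, which selects the negative root.
  have hVneg : ∀ r ∈ Ioc 0 ρ, V r 0 < 0 := by
    have hanti : StrictAntiOn (fun r => V r 0) (Icc 0 ρ) := by
      refine strictAntiOn_of_deriv_neg (convex_Icc _ _)
        (fun r hr => (hg' r hr).1.continuousWithinAt) fun r hr => ?_
      rw [interior_Icc] at hr
      have hr' := Ioo_subset_Icc_self hr
      rw [((hg' r hr').1.hasDerivAt (Icc_mem_nhds hr.1 hr.2)).deriv]
      have h1 := hpow r hr'
      have h2 := ht r hr'
      have h3 : V r 1 ≠ 0 := fun h3 => by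
        have := hK r hr'
        rw [h3, mul_zero] at this
        exact ha0.ne this
      have h4 : 0 < V r 1 * V r 1 := mul_self_pos.2 h3
      simp only [powerLaw]
      rw [neg_lt_zero]
      positivity
    intro r hr
    have := hanti ⟨le_rfl, hρ.le⟩ ⟨hr.1.le, hr.2⟩ hr.1
    simpa [hV00] using this
  set z : ℝ → ℝ := fun r => ψ r 0 ^ α / τ ^ α with hz
  have hz_mem : ∀ r ∈ Ioc 0 ρ, z r ∈ Ioo (0 : ℝ) 1 := by
    intro r hr
    have hr' : r ∈ Icc 0 ρ := ⟨hr.1.le, hr.2⟩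
    have h1 := hpow r hr'
    refine ⟨by positivity, ?_⟩
    rw [hz, div_lt_one ha0]
    have h2 := hK r hr'
    have h3 := hN r hr'
    have h4 : 0 < V r 0 * V r 0 := mul_pos_of_neg_of_neg (hVneg r hr) (hVneg r hr)
    have h5 : (ψ r 0 ^ α) ^ 2 < (τ ^ α) ^ 2 := by
      have : (τ ^ α) ^ 2 = (ψ r 0 ^ α) ^ 2 * (1 + V r 0 * V r 0) := by
        rw [← h2, ← h3]; ring
      rw [this]
      have : 0 < (ψ r 0 ^ α) ^ 2 * (V r 0 * V r 0) := by positivity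
      linarith
    exact lt_of_pow_lt_pow_left₀ 2 ha0.le h5
  have hV0 : ∀ r ∈ Ioc 0 ρ, V r 0 = -(√(1 - z r ^ 2) / z r) := by
    intro r hr
    have hr' : r ∈ Icc 0 ρ := ⟨hr.1.le, hr.2⟩
    have hzr := hz_mem r hr
    have h1 := hpow r hr'
    have h2 : V r 1 = τ ^ α / (ψ r 0 ^ α) ^ 2 := by
      rw [eq_div_iff (by positivity), mul_comm, hK r hr']
    have h3 := hN r hr'
    have h4 : (-V r 0) ^ 2 = (√(1 - z r ^ 2) / z r) ^ 2 := by
      rw [div_pow, Real.sq_sqrt (by nlinarith [hzr.1, hzr.2])]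
      rw [h2] at h3
      simp only [hz]
      field_simp
      field_simp at h3
      linear_combination -h3
    have h5 := (pow_left_inj₀ (by linarith [hVneg r hr])
      (div_nonneg (Real.sqrt_nonneg _) hzr.1.le) two_ne_zero).1 h4
    linarith
  set φ : ℝ → ℝ := fun r => Real.arccos (z r) with hφ
  have hcz : ContinuousOn z (Icc 0 ρ) :=
    ((hcψi 0).rpow_const fun r hr => Or.inl (ht r hr).ne').div_const _
  have hcφ : ContinuousOn φ (Icc 0 ρ) := Real.continuous_arccos.comp_continuousOn hcz
  have hφ0 : φ 0 = 0 := by simp [hφ, hz, h0, ha0.ne']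
  have hφ_mem : ∀ r ∈ Ioc 0 ρ, φ r ∈ Ioo 0 (Real.pi / 2) := fun r hr =>
    ⟨Real.arccos_pos.2 (hz_mem r hr).2, Real.arccos_lt_pi_div_two.2 (hz_mem r hr).1⟩
  have hcos : ∀ r ∈ Ioc 0 ρ, Real.cos (φ r) = z r := fun r hr =>
    Real.cos_arccos (by linarith [(hz_mem r hr).1]) (hz_mem r hr).2.le
  have htcos : ∀ r ∈ Ioc 0 ρ, ψ r 0 = τ * Real.cos (φ r) ^ (1 / α) := by
    intro r hr
    have h1 := ht r ⟨hr.1.le, hr.2⟩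
    rw [hcos r hr]
    simp only [hz]
    rw [← Real.div_rpow h1.le hτ.le, ← Real.rpow_mul (by positivity),
      mul_one_div_cancel hα.ne', Real.rpow_one]
    field_simp
  -- The chain rule gives `-z'/√(1 - z²)`, where `z' = α z V⁰/t` and `V⁰ = -√(1 - z²)/z`; the roots
  -- cancel.
  have hdφ : ∀ r ∈ Ioo 0 ρ, HasDerivAt φ (α / ψ r 0) r := by
    intro r hr
    have hr1 := Ioo_subset_Ioc_self hr
    have hr' := Ioo_subset_Icc_self hr
    have hzr := hz_mem r hr1
    have h1 := ht r hr'
    have hs : 0 < √(1 - z r ^ 2) := Real.sqrt_pos.2 (by nlinarith [hzr.1, hzr.2])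
    have hd0 : HasDerivAt (fun r => ψ r 0) (V r 0) r :=
      (hasDerivAt_pi.1 ((hv r hr').hasDerivAt (Icc_mem_nhds hr.1 hr.2))) 0
    have h2 := (Real.hasDerivAt_arccos (by linarith [hzr.1]) hzr.2.ne).comp r
      ((hd0.rpow_const (p := α) (Or.inl h1.ne')).div_const (τ ^ α))
    refine h2.congr_deriv ?_
    rw [hV0 r hr1, Real.rpow_sub_one h1.ne']
    have : ψ r 0 ^ α = z r * τ ^ α := by simp only [hz]; field_simp
    rw [this]
    have := hzr.1.ne'
    field_simp
  have hρ1 : ρ ∈ Ioc 0 ρ := ⟨hρ, le_rfl⟩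
  refine ⟨φ ρ, hφ_mem ρ hρ1, ?_, ?_, ?_, hV00, hV01⟩
  · have := eq_of_hasDerivAt_zero (f := fun r => τ * arcLength α (φ r) - r) hρ
      ((continuousOn_const.mul ((continuous_arcLength hα).comp_continuousOn hcφ)).sub
        continuousOn_id) fun r hr => by
          refine ((((hasStrictDerivAt_arcLength hα (φ r)).hasDerivAt.comp r
            (hdφ r hr)).const_mul τ).sub (hasDerivAt_id r)).congr_deriv ?_
          have hr1 := Ioo_subset_Ioc_self hr
          have hc := cos_pos_of_mem (Ioo_zero_subset (hφ_mem r hr1))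
          rw [htcos r hr1]
          field_simp
          ring
    rw [hφ0] at this
    simp only [arcLength_zero] at this
    linarith
  · have hsub : ∀ r ∈ Icc 0 ρ, φ r ∈ Ioo (-(Real.pi / 2)) (Real.pi / 2) := fun r hr => by
      rcases hr.1.eq_or_lt with rfl | hr0
      · rw [hφ0]; constructor <;> linarith [Real.pi_pos]
      · exact Ioo_zero_subset (hφ_mem r ⟨hr0, hr.2⟩)
    have := eq_of_hasDerivAt_zero
      (f := fun r => τ ^ (1 - α) / α * hubbleOfAngle α (φ r) - ψ r 1) hρ
      ((continuousOn_const.mul ((continuousOn_hubbleOfAngle hα hα1).comp hcφ hsub)).sub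
        (hcψi 1)) fun r hr => by
          have hr1 := Ioo_subset_Ioc_self hr
          have hr' := Ioo_subset_Icc_self hr
          have hd1 : HasDerivAt (fun r => ψ r 1) (V r 1) r :=
            (hasDerivAt_pi.1 ((hv r hr').hasDerivAt (Icc_mem_nhds hr.1 hr.2))) 1
          refine ((((hasDerivAt_hubbleOfAngle hα hα1 (hsub r hr')).comp r
            (hdφ r hr)).const_mul (τ ^ (1 - α) / α)).sub hd1).congr_deriv ?_
          have hc := cos_pos_of_mem (hsub r hr')
          have h1 := hpow r hr'
          have h2 : V r 1 = τ ^ α / (ψ r 0 ^ α) ^ 2 := by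
            rw [eq_div_iff (by positivity), mul_comm, hK r hr']
          have h3 : ψ r 0 ^ α = Real.cos (φ r) * τ ^ α := by
            rw [hcos r hr1]; simp only [hz]; field_simp
          rw [h2, h3, htcos r hr1, Real.rpow_sub hc, Real.rpow_sub hτ, Real.rpow_one,
            Real.rpow_two]
          field_simp
          ring
    rw [hφ0, h01] at this
    simp only [hubbleOfAngle_zero] at this
    ext i
    fin_cases i
    · simpa using htcos ρ hρ1
    · simp only [Fin.mk_one, Matrix.cons_val_one, Matrix.cons_val_fin_one]
      linarith
  · rw [Real.tan_eq_sin_div_cos, hcos ρ hρ1, hφ, Real.sin_arccos, hV0 ρ hρ1]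

/-! ### Explicit geodesics and parallel frames -/

/-- The position on the orthogonal geodesic from `(τ, 0)`, as a function of the angle. -/
noncomputable def geodesicPoint (α τ φ : ℝ) : Coord :=
  ![τ * Real.cos φ ^ (1 / α), τ ^ (1 - α) / α * hubbleOfAngle α φ]

/-- The vector field `A N + B V` along this geodesic, where `V` is its velocity and `N` the future
unit normal. -/
noncomputable def frameField (α τ A B φ : ℝ) : Coord :=
  ![A / Real.cos φ - B * (Real.sin φ / Real.cos φ),
    (B - A * Real.sin φ) / (τ ^ α * Real.cos φ ^ 2)]

/-- The angle at a proper length. -/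
noncomputable def angleOfLength (α τ r : ℝ) : ℝ :=
  Function.invFunOn (arcLength α) (Ioo (-(Real.pi / 2)) (Real.pi / 2)) (r / τ)

lemma angleOfLength_arcLength (hα : 0 < α) (hτ : 0 < τ)
    (h : θ ∈ Ioo (-(Real.pi / 2)) (Real.pi / 2)) :
    angleOfLength α τ (τ * arcLength α θ) = θ := by
  rw [angleOfLength, mul_div_cancel_left₀ _ hτ.ne']
  exact ((strictMonoOn_arcLength hα).injOn.mono Ioo_subset_Icc_self).leftInvOn_invFunOn h

/-- The symmetric interval of angles provides a two-sided derivative also at `θ = 0`, the start of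
the geodesic. -/
lemma hasDerivAt_angleOfLength (hα : 0 < α) (hτ : 0 < τ)
    (h : θ ∈ Ioo (-(Real.pi / 2)) (Real.pi / 2)) :
    HasDerivAt (angleOfLength α τ) (α / (τ * Real.cos θ ^ (1 / α))) (τ * arcLength α θ) := by
  have hc := cos_pos_of_mem h
  have h1 : HasStrictDerivAt (fun θ => τ * arcLength α θ) (τ * (1 / α * Real.cos θ ^ (1 / α))) θ :=
    (hasStrictDerivAt_arcLength hα θ).const_mul τ
  have h2 := h1.to_local_left_inverse (g := angleOfLength α τ) (by positivity) (by
    filter_upwards [isOpen_Ioo.mem_nhds h] with x hx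
    exact angleOfLength_arcLength hα hτ hx)
  refine h2.hasDerivAt.congr_deriv ?_
  field_simp

lemma exists_angle_of_mem_Icc (hα : 0 < α) (h : θ ∈ Ioo 0 (Real.pi / 2)) {r : ℝ}
    (hr : r ∈ Icc 0 (τ * arcLength α θ)) :
    ∃ φ ∈ Ioo (-(Real.pi / 2)) (Real.pi / 2), r = τ * arcLength α φ := by
  have := intermediate_value_Icc h.1.le
    ((continuous_const.mul (continuous_arcLength hα)).continuousOn (f := fun φ => τ * arcLength α φ))
  simp only [arcLength_zero, mul_zero] at this
  obtain ⟨φ, hφ, e⟩ := this hr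
  exact ⟨φ, ⟨by linarith [hφ.1, Real.pi_pos], hφ.2.trans_lt h.2⟩, e.symm⟩

lemma hasDerivAt_geodesicPoint (hα : 0 < α) (hα1 : α ≠ 1) (hτ : 0 < τ)
    (h : θ ∈ Ioo (-(Real.pi / 2)) (Real.pi / 2)) :
    HasDerivAt (fun r => geodesicPoint α τ (angleOfLength α τ r)) (frameField α τ 0 1 θ)
      (τ * arcLength α θ) := by
  have hc := cos_pos_of_mem h
  have hω := hasDerivAt_angleOfLength hα hτ h
  have he := angleOfLength_arcLength hα hτ h
  rw [hasDerivAt_pi, Fin.forall_fin_two]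
  constructor
  · have h1 : HasDerivAt (fun φ => τ * Real.cos φ ^ (1 / α))
        (τ * (-Real.sin θ * (1 / α) * Real.cos θ ^ (1 / α - 1))) θ :=
      ((Real.hasDerivAt_cos θ).rpow_const (Or.inl hc.ne')).const_mul τ
    refine (HasDerivAt.comp_of_eq _ h1 hω he.symm).congr_deriv ?_
    simp only [frameField, Matrix.cons_val_zero]
    rw [Real.rpow_sub_one hc.ne']
    field_simp
    ring
  · have h1 := (hasDerivAt_hubbleOfAngle hα hα1 h).const_mul (τ ^ (1 - α) / α)
    refine (HasDerivAt.comp_of_eq _ h1 hω he.symm).congr_deriv ?_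
    simp only [frameField, Matrix.cons_val_one, Matrix.cons_val_fin_one]
    rw [Real.rpow_sub hc, Real.rpow_sub hτ, Real.rpow_one, Real.rpow_two]
    field_simp
    ring

lemma time_geodesicPoint_pos (hτ : 0 < τ) (h : θ ∈ Ioo (-(Real.pi / 2)) (Real.pi / 2)) :
    0 < geodesicPoint α τ θ 0 := by
  have hc := cos_pos_of_mem h
  simp only [geodesicPoint, Matrix.cons_val_zero]
  positivity

/-- In dimension two the unit normal of a geodesic is parallel along with its velocity, so constant
coefficients `A`, `B` give a parallel field. -/
lemma isParallelAlong_frameField (hα : 0 < α) (hτ : 0 < τ) (h : θ ∈ Ioo 0 (Real.pi / 2)) (A B : ℝ) :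
    IsParallelAlong (metric (powerLaw α)) (τ * arcLength α θ)
      (fun r => geodesicPoint α τ (angleOfLength α τ r))
      (fun r => frameField α τ 0 1 (angleOfLength α τ r))
      (fun r => frameField α τ A B (angleOfLength α τ r)) := by
  rw [isParallelAlong_iff]
  · intro r hr
    obtain ⟨φ, hφ, rfl⟩ := exists_angle_of_mem_Icc hα h hr
    have he := angleOfLength_arcLength hα hτ hφ
    have hω := hasDerivAt_angleOfLength hα hτ hφ
    have hc := cos_pos_of_mem hφ
    have ha : powerLaw α (geodesicPoint α τ φ 0) = τ ^ α * Real.cos φ := by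
      simp only [geodesicPoint, powerLaw, Matrix.cons_val_zero]
      rw [Real.mul_rpow hτ.le (by positivity), ← Real.rpow_mul hc.le, one_div_mul_cancel hα.ne',
        Real.rpow_one]
    have hp : 0 < τ ^ α := Real.rpow_pos_of_pos hτ α
    have hs := Real.hasDerivAt_sin φ
    have hd := Real.hasDerivAt_cos φ
    simp only [he, ha]
    constructor
    · have h1 : HasDerivAt (fun φ => frameField α τ A B φ 0) _ φ :=
        ((hasDerivAt_const φ A).div hd hc.ne').sub ((hs.div hd hc.ne').const_mul B)
      refine ((HasDerivAt.comp_of_eq _ h1 hω he.symm).congr_deriv ?_).hasDerivWithinAt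
      simp only [frameField, geodesicPoint, Matrix.cons_val_zero, Matrix.cons_val_one,
        Matrix.cons_val_fin_one]
      field_simp
      rw [Real.cos_sq' φ]
      ring
    · have h1 : HasDerivAt (fun φ => frameField α τ A B φ 1) _ φ :=
        ((hs.const_mul A).const_sub B).div ((hd.pow 2).const_mul (τ ^ α))
          (by positivity : τ ^ α * Real.cos φ ^ 2 ≠ 0)
      refine ((HasDerivAt.comp_of_eq _ h1 hω he.symm).congr_deriv ?_).hasDerivWithinAt
      simp only [frameField, geodesicPoint, Matrix.cons_val_zero, Matrix.cons_val_one,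
        Matrix.cons_val_fin_one]
      push_cast
      field_simp
      rw [Real.cos_sq' φ]
      ring
  · intro r hr
    obtain ⟨φ, hφ, rfl⟩ := exists_angle_of_mem_Icc hα h hr
    rw [angleOfLength_arcLength hα hτ hφ]
    exact time_geodesicPoint_pos hτ hφ

lemma zero_mem_Ioo_pi : (0 : ℝ) ∈ Ioo (-(Real.pi / 2)) (Real.pi / 2) :=
  ⟨by linarith [Real.pi_pos], by linarith [Real.pi_pos]⟩

lemma angleOfLength_zero (hα : 0 < α) (hτ : 0 < τ) : angleOfLength α τ 0 = 0 := by
  simpa using angleOfLength_arcLength hα hτ zero_mem_Ioo_pi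

lemma isFermiGeodesic_geodesicPoint (hα : 0 < α) (hα1 : α ≠ 1) (hτ : 0 < τ)
    (h : θ ∈ Ioo 0 (Real.pi / 2)) :
    IsFermiGeodesic (powerLaw α) τ (τ * arcLength α θ)
      (fun r => geodesicPoint α τ (angleOfLength α τ r))
      (fun r => frameField α τ 0 1 (angleOfLength α τ r)) where
  tau_pos := hτ
  rho_pos := mul_pos hτ (arcLength_pos hα h)
  time_pos r hr := by
    obtain ⟨φ, hφ, rfl⟩ := exists_angle_of_mem_Icc hα h hr
    rw [angleOfLength_arcLength hα hτ hφ]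
    exact time_geodesicPoint_pos hτ hφ
  velocity r hr := by
    obtain ⟨φ, hφ, rfl⟩ := exists_angle_of_mem_Icc hα h hr
    rw [angleOfLength_arcLength hα hτ hφ]
    exact (hasDerivAt_geodesicPoint hα hα1 hτ hφ).hasDerivWithinAt
  geodesic := isParallelAlong_frameField hα hτ h 0 1
  start := by
    rw [angleOfLength_zero hα hτ]; simp [geodesicPoint, observer]
  orthogonal := by
    rw [angleOfLength_zero hα hτ, scalarProd_metric]; simp [frameField, observerVelocity]
  unit := by
    have hp : 0 < τ ^ α := Real.rpow_pos_of_pos hτ α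
    rw [angleOfLength_zero hα hτ, scalarProd_metric]
    simp [frameField, observer, powerLaw]
    field_simp
  outward := by
    have hp : 0 < τ ^ α := Real.rpow_pos_of_pos hτ α
    rw [angleOfLength_zero hα hτ]; simp [frameField, hp]

lemma hasFermiCoordinates_geodesicPoint (hα : 0 < α) (hα1 : α ≠ 1) (hτ : 0 < τ)
    (h : θ ∈ Ioo 0 (Real.pi / 2)) :
    HasFermiCoordinates (powerLaw α) (geodesicPoint α τ θ) τ (τ * arcLength α θ) :=
  ⟨_, _, isFermiGeodesic_geodesicPoint hα hα1 hτ h, by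
    rw [angleOfLength_arcLength hα hτ (Ioo_zero_subset h)]⟩

/-! ### The kinematic velocity -/

/-- The Hubble speed of a particle and the angle of its event on the slice. -/
lemma rpow_div_mul_hubble_eq_iff (hα : 0 < α) (hτ : 0 < τ) {v : ℝ} :
    τ ^ (1 - α) / α * v = χ ↔ v = hubbleSpeed α τ χ := by
  have hp : 0 < τ ^ (1 - α) := Real.rpow_pos_of_pos hτ _
  rw [hubbleSpeed, show α - 1 = -(1 - α) by ring, Real.rpow_neg hτ.le]
  constructor
  · rintro rfl; field_simp
  · rintro rfl; field_simp

/-- The product of `W` with the geodesic velocity is conserved and equals `tan θ` at the particle;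
the conserved norm of `W` then gives `W 0 0 = 1 / cos θ` up to sign. -/
lemma isKinematicVelocity_iff (hα : 0 < α) (hα1 : α ≠ 1) (hτ : 0 < τ)
    (h : θ ∈ Ioo 0 (Real.pi / 2)) (hχ : hubbleOfAngle α θ = hubbleSpeed α τ χ) (w : Coord) :
    IsKinematicVelocity (powerLaw α) (comoving χ) τ w ↔
      w = Real.sin θ • radialUnit (powerLaw α) τ := by
  have hp : 0 < τ ^ α := Real.rpow_pos_of_pos hτ α
  have hcom : ∀ s, HasDerivAt (comoving χ) ![1, 0] s := fun s => by
    rw [hasDerivAt_pi, Fin.forall_fin_two]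
    exact ⟨hasDerivAt_id s, hasDerivAt_const s χ⟩
  have hc := cos_pos_of_mem (Ioo_zero_subset h)
  have hs : 0 < Real.sin θ := Real.sin_pos_of_pos_of_lt_pi h.1 (by linarith [h.2, Real.pi_pos])
  constructor
  · rintro ⟨s, ρ, u', ψ, V, W, hψ, hend, hu', hW, hWρ, rfl⟩
    obtain ⟨φ, hφ, hρ, hψρ, hVρ, hV00, hV01⟩ := hψ.exists_angle hα hα1
    have hφθ : φ = θ := by
      have := congrFun (hψρ.symm.trans hend) 1
      simp only [comoving, Matrix.cons_val_one, Matrix.cons_val_fin_one] at this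
      rw [rpow_div_mul_hubble_eq_iff hα hτ, ← hχ] at this
      exact (strictMonoOn_hubbleOfAngle hα hα1).injOn (Ioo_zero_subset hφ) (Ioo_zero_subset h) this
    subst hφθ
    rw [hu'.unique (hcom s)] at hWρ
    have hρ0 := hψ.rho_pos
    have hmem : ρ ∈ Icc 0 ρ := ⟨hρ0.le, le_rfl⟩
    have h0 : ψ 0 0 = τ := by rw [hψ.start]; simp [observer]
    have hWV := scalarProd_eq_of_isParallelAlong hψ.time_pos hψ.velocity hW hψ.geodesic hmem
    have hWW := fun r hr =>
      scalarProd_eq_of_isParallelAlong (r := r) hψ.time_pos hψ.velocity hW hW hr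
    have hW1 : W 0 1 = Real.tan φ / τ ^ α := by
      rw [hWρ, hVρ, hV00, hV01, h0] at hWV
      simp only [powerLaw, Matrix.cons_val_zero, Matrix.cons_val_one,
        Matrix.cons_val_fin_one] at hWV
      field_simp at hWV ⊢
      linarith
    have hWW0 := hWW ρ hmem
    -- A timelike vector has nonzero time component, so by continuity the sign at the particle
    -- persists back to the observer.
    have hneg : ∀ r ∈ Icc 0 ρ, W r 0 ≠ 0 := by
      intro r hr h00
      have e := (hWW r hr).trans hWW0.symm
      rw [hWρ, h00] at e
      simp only [Matrix.cons_val_zero, Matrix.cons_val_one, Matrix.cons_val_fin_one] at e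
      have : 0 ≤ powerLaw α (ψ r 0) ^ 2 * (W r 1 * W r 1) :=
        mul_nonneg (sq_nonneg _) (mul_self_nonneg _)
      linarith
    have hW0pos : 0 < W 0 0 := by
      by_contra hle
      have hcont : ContinuousOn (fun r => W r 0) (Icc 0 ρ) := fun r hr =>
        (((isParallelAlong_iff hψ.time_pos).1 hW) r hr).1.continuousWithinAt
      obtain ⟨r, hr, e⟩ := intermediate_value_Icc hρ0.le hcont
        (show (0 : ℝ) ∈ Icc (W 0 0) (W ρ 0) from ⟨not_lt.1 hle, by rw [hWρ]; simp⟩)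
      exact hneg r hr e
    have hW0 : W 0 0 = 1 / Real.cos φ := by
      rw [hWρ, hW1, h0, Real.tan_eq_sin_div_cos] at hWW0
      simp only [powerLaw, Matrix.cons_val_zero, Matrix.cons_val_one,
        Matrix.cons_val_fin_one] at hWW0
      have e : (W 0 0) ^ 2 = (1 / Real.cos φ) ^ 2 := by
        field_simp at hWW0 ⊢
        linear_combination hWW0 + Real.sin_sq_add_cos_sq φ
      exact (pow_left_inj₀ hW0pos.le (by positivity) two_ne_zero).1 e
    rw [scalarProd_metric]
    ext i
    fin_cases i
    · simp [observerVelocity, radialUnit, hW0, hc.ne']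
    · simp [observerVelocity, radialUnit, hW0, hW1, Real.tan_eq_sin_div_cos, powerLaw]
      field_simp
  · rintro rfl
    have hend := angleOfLength_arcLength hα hτ (Ioo_zero_subset h)
    refine ⟨τ * Real.cos θ ^ (1 / α), τ * arcLength α θ, ![1, 0], _, _,
      -- These coefficients are the components of `∂/∂t` at the particle in the frame of normal and
      -- velocity.
      fun r => frameField α τ (1 / Real.cos θ) (Real.sin θ / Real.cos θ) (angleOfLength α τ r),
      isFermiGeodesic_geodesicPoint hα hα1 hτ h, ?_, hcom _,
      isParallelAlong_frameField hα hτ h _ _, ?_, ?_⟩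
    · rw [hend, geodesicPoint, (rpow_div_mul_hubble_eq_iff hα hτ).2 hχ, comoving]
    · simp only [hend, frameField]
      congr 1
      · field_simp
        linarith [Real.sin_sq_add_cos_sq θ]
      · congr 1
        field_simp
        ring
    · simp only [angleOfLength_zero hα hτ]
      rw [scalarProd_metric]
      ext i
      fin_cases i
      · simp [observerVelocity, radialUnit, frameField, hc.ne']
      · simp [observerVelocity, radialUnit, frameField, powerLaw]
        field_simp

/-! ### The Fermi velocity -/

/-- The Fermi speed of the particle on the slice at a given angle. -/
noncomputable def fermiSpeedOfAngle (α θ : ℝ) : ℝ :=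
  Real.sin θ ^ 2 * arcLength α θ + Real.cos θ ^ (1 / α + 1) * Real.sin θ

lemma cos_rpow_one_div_add_one (hα : 0 < α) (h : θ ∈ Ioo 0 (Real.pi / 2)) :
    Real.cos θ ^ (1 / α + 1) = Real.cos θ ^ ((1 - α) / α) * Real.cos θ ^ 2 := by
  rw [← Real.rpow_add_natCast (cos_pos_of_mem (Ioo_zero_subset h)).ne']
  congr 1
  push_cast
  field_simp
  ring

lemma fermiSpeedOfAngle_eq (hα : 0 < α) (hα1 : α ≠ 1) (h : θ ∈ Ioo 0 (Real.pi / 2)) :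
    fermiSpeedOfAngle α θ
      = arcLength α θ + (α - 1) / α * Real.cos θ ^ 2 * hubbleOfAngle α θ := by
  rw [fermiSpeedOfAngle, cos_rpow_one_div_add_one hα h, Real.sin_sq]
  linear_combination -Real.cos θ ^ 2 * arcLength_eq hα hα1 θ

lemma HasFermiCoordinates.exists_angle (hα : 0 < α) (hα1 : α ≠ 1) {s T R : ℝ}
    (h : HasFermiCoordinates (powerLaw α) (comoving χ s) T R) :
    0 < T ∧ ∃ φ ∈ Ioo 0 (Real.pi / 2), R = T * arcLength α φ ∧ s = T * Real.cos φ ^ (1 / α) ∧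
      hubbleOfAngle α φ = hubbleSpeed α T χ := by
  obtain ⟨ψ, V, hψ, hend⟩ := h
  obtain ⟨φ, hφ, hR, hψR, -⟩ := hψ.exists_angle hα hα1
  have e := hend.symm.trans hψR
  refine ⟨hψ.tau_pos, φ, hφ, hR, congrFun e 0, ?_⟩
  exact (rpow_div_mul_hubble_eq_iff hα hψ.tau_pos).1 (congrFun e 1).symm

lemma eq_arccos_of_eq (hα : 0 < α) {s T : ℝ} (hT : 0 < T) (h : θ ∈ Ioo 0 (Real.pi / 2))
    (hs : s = T * Real.cos θ ^ (1 / α)) : Real.arccos ((s / T) ^ α) = θ := by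
  have hc := cos_pos_of_mem (Ioo_zero_subset h)
  rw [hs, mul_div_cancel_left₀ _ hT.ne', ← Real.rpow_mul hc.le, one_div_mul_cancel hα.ne',
    Real.rpow_one, Real.arccos_cos h.1.le (by linarith [h.2, Real.pi_pos])]

lemma hasDerivAt_hubbleSpeed (hτ : 0 < τ) :
    HasDerivAt (fun t => hubbleSpeed α t χ) ((α - 1) / τ * hubbleSpeed α τ χ) τ := by
  have := (Real.hasDerivAt_rpow_const (p := α - 1) (Or.inl hτ.ne')).const_mul (α * χ)
  refine this.congr_deriv ?_
  rw [hubbleSpeed, Real.rpow_sub_one hτ.ne' (α - 1)]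
  field_simp

/-- Implicit differentiation along the world line: `X(Φ) = v(T)` determines `Φ'` in terms of `T'`,
and `R = T L(Φ)` then determines `R'`. -/
lemma IsFermiVelocity.eq (hα : 0 < α) (hα1 : α ≠ 1)
    (h : θ ∈ Ioo 0 (Real.pi / 2)) (hχ : hubbleOfAngle α θ = hubbleSpeed α τ χ) {w : Coord}
    (hw : IsFermiVelocity (powerLaw α) (comoving χ) τ w) :
    w = fermiSpeedOfAngle α θ • radialUnit (powerLaw α) τ := by
  obtain ⟨s, T', R', T, R, hev, hTs, hT, hR, hT', rfl⟩ := hw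
  -- The angle is recovered from `r` and `T r` alone, so its differentiability follows from that of
  -- `T`.
  set Φ : ℝ → ℝ := fun r => Real.arccos ((r / T r) ^ α) with hΦ
  have key : ∀ r, HasFermiCoordinates (powerLaw α) (comoving χ r) (T r) (R r) →
      Φ r ∈ Ioo 0 (Real.pi / 2) ∧ R r = T r * arcLength α (Φ r) ∧
      hubbleOfAngle α (Φ r) = hubbleSpeed α (T r) χ := by
    intro r hr
    obtain ⟨hTr, φ, hφ, h1, h2, h3⟩ := HasFermiCoordinates.exists_angle hα hα1 hr
    have : Φ r = φ := eq_arccos_of_eq hα hTr hφ h2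
    rw [this]
    exact ⟨hφ, h1, h3⟩
  obtain ⟨hτ, φ, hφ, h1, h2, h3⟩ := HasFermiCoordinates.exists_angle hα hα1 hev.self_of_nhds
  rw [hTs] at h2 h3 hτ
  have hφθ : φ = θ := (strictMonoOn_hubbleOfAngle hα hα1).injOn (Ioo_zero_subset hφ)
    (Ioo_zero_subset h) (h3.trans hχ.symm)
  subst hφθ
  have hΦs : Φ s = φ := by rw [hΦ]; simp only [hTs]; exact eq_arccos_of_eq hα hτ hφ h2
  have hc := cos_pos_of_mem (Ioo_zero_subset hφ)
  have hsT : 0 < s / τ := by rw [h2, mul_div_cancel_left₀ _ hτ.ne']; positivity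
  have hcos := cos_mem_Ioo hφ
  obtain ⟨Φ', hΦ'⟩ : ∃ Φ', HasDerivAt Φ Φ' s := by
    have hz : (s / T s) ^ α = Real.cos φ := by
      rw [hTs, h2, mul_div_cancel_left₀ _ hτ.ne', ← Real.rpow_mul hc.le,
        one_div_mul_cancel hα.ne', Real.rpow_one]
    have h5 : HasDerivAt (fun r => (r / T r) ^ α) _ s :=
      ((hasDerivAt_id s).div hT (by rw [hTs]; exact hτ.ne')).rpow_const
        (p := α) (Or.inl (by simpa [hTs] using hsT.ne'))
    have h6 := Real.hasDerivAt_arccos (x := (s / T s) ^ α) (by rw [hz]; linarith [hcos.1])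
      (by rw [hz]; exact hcos.2.ne)
    exact ⟨_, HasDerivAt.comp (h₂ := Real.arccos) (h := fun r => (r / T r) ^ α) s h6 h5⟩
  have hX : Real.cos φ ^ (1 / α - 2) * Φ' = (α - 1) / τ * hubbleSpeed α τ χ * T' := by
    have d1 := HasDerivAt.comp_of_eq s (hasDerivAt_hubbleOfAngle hα hα1 (Ioo_zero_subset hφ)) hΦ'
      hΦs.symm
    have d2 := HasDerivAt.comp_of_eq s (hasDerivAt_hubbleSpeed (α := α) (χ := χ) hτ) hT hTs.symm
    refine d1.unique (d2.congr_of_eventuallyEq ?_)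
    filter_upwards [hev] with r hr
    exact (key r hr).2.2
  have hR2 : R' = T' * arcLength α φ + τ * (1 / α * Real.cos φ ^ (1 / α) * Φ') := by
    have d1 := HasDerivAt.comp_of_eq s (hasStrictDerivAt_arcLength hα φ).hasDerivAt hΦ' hΦs.symm
    have d2 := hT.mul d1
    simp only [Function.comp_apply, hΦs, hTs] at d2
    refine hR.unique (d2.congr_of_eventuallyEq ?_)
    filter_upwards [hev] with r hr
    exact (key r hr).2.1
  congr 1
  rw [fermiSpeedOfAngle_eq hα hα1 hφ, h3, hR2]
  have e3 : Real.cos φ ^ (1 / α) = Real.cos φ ^ (1 / α - 2) * Real.cos φ ^ 2 := by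
    rw [← Real.rpow_add_natCast hc.ne']; congr 1; push_cast; ring
  rw [e3, show τ * (1 / α * (Real.cos φ ^ (1 / α - 2) * Real.cos φ ^ 2) * Φ')
    = τ * (1 / α) * Real.cos φ ^ 2 * (Real.cos φ ^ (1 / α - 2) * Φ') by ring, hX]
  field_simp

/-- The proper time of the central observer at which the particle is at a given angle. -/
noncomputable def timeOfAngle (α χ φ : ℝ) : ℝ := (hubbleOfAngle α φ / (α * χ)) ^ (1 / (α - 1))

lemma timeOfAngle_pos (hα : 0 < α) (hα1 : α ≠ 1) (hχ : 0 < χ) (h : θ ∈ Ioo 0 (Real.pi / 2)) :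
    0 < timeOfAngle α χ θ := by
  have := hubbleOfAngle_pos hα hα1 h
  rw [timeOfAngle]
  positivity

lemma hubbleSpeed_timeOfAngle (hα : 0 < α) (hα1 : α ≠ 1) (hχ : 0 < χ)
    (h : θ ∈ Ioo 0 (Real.pi / 2)) :
    hubbleOfAngle α θ = hubbleSpeed α (timeOfAngle α χ θ) χ := by
  have := hubbleOfAngle_pos hα hα1 h
  rw [hubbleSpeed, timeOfAngle, ← Real.rpow_mul (by positivity),
    one_div_mul_cancel (sub_ne_zero.2 hα1), Real.rpow_one]
  field_simp

lemma timeOfAngle_eq (hα : 0 < α) (hα1 : α ≠ 1) (hτ : 0 < τ) (hχ : 0 < χ)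
    (h : hubbleOfAngle α θ = hubbleSpeed α τ χ) : timeOfAngle α χ θ = τ := by
  rw [timeOfAngle, h, hubbleSpeed, mul_div_cancel_left₀ _ (by positivity), ← Real.rpow_mul hτ.le,
    mul_one_div_cancel (sub_ne_zero.2 hα1), Real.rpow_one]

lemma hasStrictDerivAt_timeOfAngle (hα : 0 < α) (hα1 : α ≠ 1) (hχ : 0 < χ)
    (h : θ ∈ Ioo 0 (Real.pi / 2)) :
    HasStrictDerivAt (timeOfAngle α χ)
      (timeOfAngle α χ θ * Real.cos θ ^ (1 / α - 2) / ((α - 1) * hubbleOfAngle α θ)) θ := by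
  have hX := hubbleOfAngle_pos hα hα1 h
  have hq : 0 < hubbleOfAngle α θ / (α * χ) := by positivity
  have h1 := (Real.hasStrictDerivAt_rpow_const (p := 1 / (α - 1)) (Or.inl hq.ne')).comp θ
    ((hasStrictDerivAt_hubbleOfAngle hα hα1 (Ioo_zero_subset h)).div_const (α * χ))
  refine h1.congr_deriv ?_
  have : α - 1 ≠ 0 := sub_ne_zero.2 hα1
  rw [Real.rpow_sub_one hq.ne', timeOfAngle]
  field_simp

/-- The world line is parametrized by the angle `φ`: the observer time is `timeOfAngle α χ φ` and
the event time is this times `cos^(1/α) φ`. Inverting the event time locally gives differentiable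
`T` and `R`. -/
lemma exists_isFermiVelocity (hα : 0 < α) (hα1 : α ≠ 1) (hτ : 0 < τ) (hχ : 0 < χ)
    (h : θ ∈ Ioo 0 (Real.pi / 2)) (hv : hubbleOfAngle α θ = hubbleSpeed α τ χ) :
    ∃ w, IsFermiVelocity (powerLaw α) (comoving χ) τ w := by
  have hX := hubbleOfAngle_pos hα hα1 h
  have hc := cos_pos_of_mem (Ioo_zero_subset h)
  have hs : 0 < Real.sin θ := Real.sin_pos_of_pos_of_lt_pi h.1 (by linarith [h.2, Real.pi_pos])
  have hα2 : α - 1 ≠ 0 := sub_ne_zero.2 hα1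
  have hTτ := timeOfAngle_eq hα hα1 hτ hχ hv
  have dT := hasStrictDerivAt_timeOfAngle hα hα1 hχ h
  rw [hTτ] at dT
  set D := τ * Real.cos θ ^ (1 / α - 2) / ((α - 1) * hubbleOfAngle α θ) with hD
  have hD0 : D ≠ 0 := by
    have := Real.rpow_pos_of_pos hc (1 / α - 2)
    exact div_ne_zero (by positivity) (mul_ne_zero hα2 hX.ne')
  -- Eliminating `X` from the numerator by `arcLength_eq` leaves a bracket of two positive terms, so
  -- the derivative is visibly nonzero.
  have dS : HasStrictDerivAt (fun φ => timeOfAngle α χ φ * Real.cos φ ^ (1 / α))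
      (τ * Real.cos θ ^ ((1 - α) / α) * (Real.cos θ ^ (1 / α + 1) + arcLength α θ * Real.sin θ)
        / ((α - 1) * hubbleOfAngle α θ)) θ := by
    have h1 := dT.mul ((Real.hasStrictDerivAt_rpow_const (p := 1 / α) (Or.inl hc.ne')).comp θ
      (Real.hasStrictDerivAt_cos θ))
    refine h1.congr_deriv ?_
    have e1 : Real.cos θ ^ (1 / α) = Real.cos θ ^ ((1 - α) / α) * Real.cos θ := by
      rw [← Real.rpow_add_one hc.ne']; congr 1; field_simp; ring
    have e2 : Real.cos θ ^ (1 / α - 1) = Real.cos θ ^ ((1 - α) / α) := by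
      congr 1; field_simp
    have e3 : Real.cos θ ^ (1 / α - 2) = Real.cos θ ^ ((1 - α) / α) / Real.cos θ := by
      rw [← Real.rpow_sub_one hc.ne']; congr 1; field_simp; ring
    simp only [Function.comp_apply, hTτ, hD]
    rw [e1, e2, e3, cos_rpow_one_div_add_one hα h, arcLength_eq hα hα1 θ]
    generalize Real.cos θ ^ ((1 - α) / α) = q
    field_simp
    linear_combination (-α * q ^ 2) * Real.sin_sq_add_cos_sq θ
  have hS0 : τ * Real.cos θ ^ ((1 - α) / α)
      * (Real.cos θ ^ (1 / α + 1) + arcLength α θ * Real.sin θ)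
        / ((α - 1) * hubbleOfAngle α θ) ≠ 0 := by
    have := arcLength_pos hα h
    exact div_ne_zero (by positivity) (mul_ne_zero hα2 hX.ne')
  set g := HasStrictDerivAt.localInverse _ _ _ dS hS0 with hg
  have dg := (dS.to_localInverse hS0).hasDerivAt
  rw [← hg] at dg
  have hgr := dS.eventually_right_inverse hS0
  have hgl := (dS.eventually_left_inverse hS0).self_of_nhds
  rw [← hg] at hgr hgl
  have hmem : ∀ᶠ r in 𝓝 (timeOfAngle α χ θ * Real.cos θ ^ (1 / α)),
      g r ∈ Ioo 0 (Real.pi / 2) :=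
    dg.continuousAt.eventually_mem (by rw [hgl]; exact isOpen_Ioo.mem_nhds h)
  have dT2 := HasDerivAt.comp_of_eq _ dT.hasDerivAt dg hgl.symm
  have dR := dT2.mul
    (HasDerivAt.comp_of_eq _ (hasStrictDerivAt_arcLength hα θ).hasDerivAt dg hgl.symm)
  refine ⟨_, _, _, _, fun r => timeOfAngle α χ (g r),
    fun r => timeOfAngle α χ (g r) * arcLength α (g r), ?_, ?_, dT2, dR, ?_, rfl⟩
  · filter_upwards [hgr, hmem] with r hr hm
    have hT := timeOfAngle_pos hα hα1 hχ hm
    have := hasFermiCoordinates_geodesicPoint hα hα1 hT hm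
    rwa [geodesicPoint, (rpow_div_mul_hubble_eq_iff hα hT).2
      (hubbleSpeed_timeOfAngle hα hα1 hχ hm), hr] at this
  · exact (congrArg _ hgl).trans hTτ
  · exact mul_ne_zero hD0 (inv_ne_zero hS0)

lemma isFermiVelocity_iff (hα : 0 < α) (hα1 : α ≠ 1) (hτ : 0 < τ) (hχ : 0 < χ)
    (h : θ ∈ Ioo 0 (Real.pi / 2)) (hv : hubbleOfAngle α θ = hubbleSpeed α τ χ) (w : Coord) :
    IsFermiVelocity (powerLaw α) (comoving χ) τ w ↔
      w = fermiSpeedOfAngle α θ • radialUnit (powerLaw α) τ := by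
  refine ⟨fun hw => hw.eq hα hα1 h hv, ?_⟩
  rintro rfl
  obtain ⟨w, hw⟩ := exists_isFermiVelocity hα hα1 hτ hχ h hv
  exact hw.eq hα hα1 h hv ▸ hw

/-! ### Norms of the two velocities -/

lemma speed_smul_radialUnit (hτ : 0 < τ) (c : ℝ) :
    speed (powerLaw α) τ (c • radialUnit (powerLaw α) τ) = |c| := by
  have := powerLaw_pos (α := α) hτ
  rw [speed, scalarProd_metric, ← Real.sqrt_sq_eq_abs]
  congr 1
  simp [radialUnit, observer]
  field_simp

lemma sin_pos_of_mem (h : θ ∈ Ioo 0 (Real.pi / 2)) : 0 < Real.sin θ :=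
  Real.sin_pos_of_pos_of_lt_pi h.1 (by linarith [h.2, Real.pi_pos])

lemma speed_kinematicVelocity (hα : 0 < α) (hα1 : α ≠ 1) (hτ : 0 < τ)
    (h : θ ∈ Ioo 0 (Real.pi / 2)) (hv : hubbleOfAngle α θ = hubbleSpeed α τ χ) :
    speed (powerLaw α) τ (kinematicVelocity (powerLaw α) (comoving χ) τ) = Real.sin θ := by
  have := Classical.epsilon_spec ⟨_, (isKinematicVelocity_iff hα hα1 hτ h hv _).2 rfl⟩
  rw [isKinematicVelocity_iff hα hα1 hτ h hv] at this
  rw [kinematicVelocity, this, speed_smul_radialUnit hτ, abs_of_pos (sin_pos_of_mem h)]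

lemma fermiSpeedOfAngle_pos (hα : 0 < α) (h : θ ∈ Ioo 0 (Real.pi / 2)) :
    0 < fermiSpeedOfAngle α θ := by
  have := sin_pos_of_mem h
  have := cos_pos_of_mem (Ioo_zero_subset h)
  have := arcLength_pos hα h
  rw [fermiSpeedOfAngle]
  positivity

lemma speed_fermiVelocity (hα : 0 < α) (hα1 : α ≠ 1) (hτ : 0 < τ) (hχ : 0 < χ)
    (h : θ ∈ Ioo 0 (Real.pi / 2)) (hv : hubbleOfAngle α θ = hubbleSpeed α τ χ) :
    speed (powerLaw α) τ (fermiVelocity (powerLaw α) (comoving χ) τ)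
      = fermiSpeedOfAngle α θ := by
  have := Classical.epsilon_spec ⟨_, (isFermiVelocity_iff hα hα1 hτ hχ h hv _).2 rfl⟩
  rw [isFermiVelocity_iff hα hα1 hτ hχ h hv] at this
  rw [fermiVelocity, this, speed_smul_radialUnit hτ, abs_of_pos (fermiSpeedOfAngle_pos hα h)]

lemma hubbleSpeed_pos (hα : 0 < α) (hτ : 0 < τ) (hχ : 0 < χ) : 0 < hubbleSpeed α τ χ := by
  rw [hubbleSpeed]; positivity

lemma continuous_fermiSpeedOfAngle (hα : 0 < α) : Continuous (fermiSpeedOfAngle α) :=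
  ((Real.continuous_sin.pow 2).mul (continuous_arcLength hα)).add
    ((Real.continuous_cos.rpow_const fun _ => Or.inr (by positivity)).mul Real.continuous_sin)

lemma fermiSpeedOfAngle_pi_div_two (hα : 0 < α) :
    fermiSpeedOfAngle α (Real.pi / 2) = constC α := by
  rw [fermiSpeedOfAngle, arcLength_pi_div_two hα, Real.sin_pi_div_two, Real.cos_pi_div_two,
    Real.zero_rpow (by positivity)]
  ring

/-! ### Limits at the maximal Hubble speed -/

/-- The angle on the slice at `τ` of the particle with coordinate `χ`, for `p = (τ, χ)`. -/
noncomputable def angleOfParticle (α : ℝ) (p : ℝ × ℝ) : ℝ :=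
  Function.invFunOn (hubbleOfAngle α) (Ioo 0 (Real.pi / 2)) (hubbleSpeed α p.1 p.2)

lemma eventually_mem_toHubbleMax {c : EReal} (hc : c < hubbleMax α) :
    ∀ᶠ p in toHubbleMax α, (0 < p.1 ∧ 0 < p.2) ∧ c < (hubbleSpeed α p.1 p.2 : EReal) ∧
      (hubbleSpeed α p.1 p.2 : EReal) < hubbleMax α := by
  refine (Filter.Eventually.and ?_ ?_)
  · exact mem_inf_of_right (mem_principal_self _)
  · exact mem_inf_of_left (preimage_mem_comap (Ioo_mem_nhdsLT hc))

lemma angleOfParticle_spec (hα : 0 < α) (hα1 : α ≠ 1) {p : ℝ × ℝ} (hp : 0 < p.1 ∧ 0 < p.2)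
    (hv : (hubbleSpeed α p.1 p.2 : EReal) < hubbleMax α) :
    angleOfParticle α p ∈ Ioo 0 (Real.pi / 2) ∧
      hubbleOfAngle α (angleOfParticle α p) = hubbleSpeed α p.1 p.2 :=
  have h := exists_hubbleOfAngle_eq hα hα1 (hubbleSpeed_pos hα hp.1 hp.2) hv
  ⟨Function.invFunOn_mem h, Function.invFunOn_eq h⟩

lemma tendsto_angleOfParticle (hα : 0 < α) (hα1 : α ≠ 1) :
    Tendsto (angleOfParticle α) (toHubbleMax α) (𝓝 (Real.pi / 2)) := by
  have key : ∀ a < Real.pi / 2, ∀ᶠ p in toHubbleMax α,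
      a < angleOfParticle α p ∧ angleOfParticle α p < Real.pi / 2 := by
    intro a ha
    -- The maximum makes the comparison angle positive, so its Hubble speed is below the bound;
    -- monotonicity then transfers the inequality to angles.
    have hm : max a (Real.pi / 4) ∈ Ioo 0 (Real.pi / 2) :=
      ⟨lt_max_of_lt_right (by linarith [Real.pi_pos]), max_lt ha (by linarith [Real.pi_pos])⟩
    filter_upwards [eventually_mem_toHubbleMax (hubbleOfAngle_lt_hubbleMax hα hm)]
      with p hp
    obtain ⟨h1, h2⟩ := angleOfParticle_spec hα hα1 hp.1 hp.2.2
    refine ⟨(le_max_left a (Real.pi / 4)).trans_lt ?_, h1.2⟩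
    have h3 := hp.2.1
    rw [EReal.coe_lt_coe_iff, ← h2] at h3
    exact ((strictMonoOn_hubbleOfAngle hα hα1).lt_iff_lt (Ioo_zero_subset hm)
      (Ioo_zero_subset h1)).1 h3
  refine tendsto_order.2 ⟨fun a ha => (key a ha).mono fun _ h => h.1, fun a ha => ?_⟩
  exact (key 0 (by linarith [Real.pi_pos])).mono fun _ h => h.2.trans ha

lemma hubbleMax_pos (hα : 0 < α) (hα1 : α ≠ 1) : 0 < hubbleMax α := by
  have h : Real.pi / 4 ∈ Ioo 0 (Real.pi / 2) := by
    constructor <;> linarith [Real.pi_pos]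
  refine lt_trans ?_ (hubbleOfAngle_lt_hubbleMax hα h)
  exact_mod_cast hubbleOfAngle_pos hα hα1 h

/-! ### The proper radius of the slice -/

lemma isLUB_sliceLengths (hα : 0 < α) (hα1 : α ≠ 1) (hτ : 0 < τ) :
    IsLUB (sliceLengths (powerLaw α) τ) (τ * constC α) := by
  constructor
  · rintro ρ ⟨ψ, V, h⟩
    obtain ⟨θ, hθ, rfl, -⟩ := h.exists_angle hα hα1
    exact mul_le_mul_of_nonneg_left (arcLength_lt_constC hα hθ).le hτ.le
  · intro b hb
    have hl : Tendsto (fun θ => τ * arcLength α θ) (𝓝[<] (Real.pi / 2)) (𝓝 (τ * constC α)) := by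
      rw [← arcLength_pi_div_two hα]
      exact ((continuous_const.mul (continuous_arcLength hα)).tendsto _).mono_left
        nhdsWithin_le_nhds
    refine le_of_tendsto hl ?_
    filter_upwards [Ioo_mem_nhdsLT (show (0 : ℝ) < Real.pi / 2 by linarith [Real.pi_pos])]
      with θ hθ
    exact hb ⟨_, _, isFermiGeodesic_geodesicPoint hα hα1 hτ hθ⟩

/-- The substitution `cos θ = a(t)/a(τ)` turns the radius integral into the length integral, which
supplies this primitive. -/
lemma hasDerivAt_sliceRadius_integrand (hα : 0 < α) (hτ : 0 < τ) {t : ℝ} (ht : t ∈ Ioo 0 τ) :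
    HasDerivAt (fun t => -(τ * arcLength α (Real.arccos (t ^ α / τ ^ α))))
      (powerLaw α t / √(powerLaw α τ ^ 2 - powerLaw α t ^ 2)) t := by
  have ha := Real.rpow_pos_of_pos hτ α
  have hb := Real.rpow_pos_of_pos ht.1 α
  have hz : t ^ α / τ ^ α ∈ Ioo (0 : ℝ) 1 :=
    ⟨by positivity, (div_lt_one ha).2 (Real.rpow_lt_rpow ht.1.le ht.2 hα)⟩
  have h1 := (HasDerivAt.comp (h := fun t : ℝ => t ^ α / τ ^ α) t
    (hasDerivAt_arcLength_arccos hα hz) ((Real.hasDerivAt_rpow_const (p := α)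
      (Or.inl ht.1.ne')).div_const (τ ^ α))).const_mul τ |>.neg
  refine h1.congr_deriv ?_
  have e1 : (t ^ α / τ ^ α) ^ (1 / α) = t / τ := by
    rw [← Real.div_rpow ht.1.le hτ.le, ← Real.rpow_mul (div_nonneg ht.1.le hτ.le),
      mul_one_div_cancel hα.ne', Real.rpow_one]
  have e2 : √(powerLaw α τ ^ 2 - powerLaw α t ^ 2) = τ ^ α * √(1 - (t ^ α / τ ^ α) ^ 2) := by
    rw [← Real.sqrt_sq ha.le, ← Real.sqrt_mul (sq_nonneg _), Real.sqrt_sq ha.le]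
    congr 1
    simp only [powerLaw]
    field_simp
  have hs : 0 < √(1 - (t ^ α / τ ^ α) ^ 2) :=
    Real.sqrt_pos.2 (by nlinarith [hz.1, hz.2])
  rw [e1, e2, Real.rpow_sub_one ht.1.ne', powerLaw]
  have := ht.1.ne'
  generalize √(1 - (t ^ α / τ ^ α) ^ 2) = q at *
  field_simp

lemma continuous_sliceRadius_primitive (hα : 0 < α) :
    Continuous fun t => -(τ * arcLength α (Real.arccos (t ^ α / τ ^ α))) :=
  (continuous_const.mul ((continuous_arcLength hα).comp (Real.continuous_arccos.comp
    ((Real.continuous_rpow_const hα.le).div_const _)))).neg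

lemma intervalIntegrable_sliceRadius (hα : 0 < α) (hτ : 0 < τ) :
    IntervalIntegrable (fun t => powerLaw α t / √(powerLaw α τ ^ 2 - powerLaw α t ^ 2))
      MeasureTheory.volume 0 τ := by
  refine intervalIntegral.intervalIntegrable_deriv_of_nonneg
    (continuous_sliceRadius_primitive hα).continuousOn
    (fun t ht => hasDerivAt_sliceRadius_integrand hα hτ ?_) fun t ht => ?_
  · simpa [hτ.le] using ht
  · have : 0 < t := by simpa [hτ.le] using ht.1
    have := powerLaw_pos (α := α) this
    positivity

lemma sliceRadius_eq (hα : 0 < α) (hτ : 0 < τ) : sliceRadius (powerLaw α) τ = τ * constC α := by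
  rw [sliceRadius, intervalIntegral.integral_eq_sub_of_hasDerivAt_of_le hτ.le
    (continuous_sliceRadius_primitive hα).continuousOn
    (fun t ht => hasDerivAt_sliceRadius_integrand hα hτ ht) (intervalIntegrable_sliceRadius hα hτ),
    div_self (Real.rpow_pos_of_pos hτ α).ne', Real.zero_rpow hα.ne', zero_div, Real.arccos_one,
    Real.arccos_zero, arcLength_pi_div_two hα, arcLength_zero]
  ring

end RobertsonWalker

theorem mainTheorem6 (α : ℝ) (hα : 0 < α) (hα1 : α ≠ 1) :
    -- the kinematic and Fermi velocities exist, are unique, and have the stated norms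
    (∀ τ χ v : ℝ, 0 < τ → 0 < χ → v = hubbleSpeed α τ χ → (v : EReal) < hubbleMax α →
      (∃! z, z ∈ Set.Ioo (0 : ℝ) 1 ∧ funF α z = constC α + (α - 1) / α * v) ∧
      (∃! w, IsKinematicVelocity (powerLaw α) (comoving χ) τ w) ∧
      (∃! w, IsFermiVelocity (powerLaw α) (comoving χ) τ w) ∧
      speed (powerLaw α) τ (kinematicVelocity (powerLaw α) (comoving χ) τ) =
        √(1 - funG α v ^ (2 * α)) ∧
      speed (powerLaw α) τ (fermiVelocity (powerLaw α) (comoving χ) τ) =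
        funG α v ^ (1 - α) * √(1 - funG α v ^ (2 * α))
          - (α - 1) / α * (1 - funG α v ^ (2 * α)) * v) ∧
    -- the limits of both speeds as the Hubble speed tends to its bound
    Filter.Tendsto
      (fun p : ℝ × ℝ =>
        speed (powerLaw α) p.1 (kinematicVelocity (powerLaw α) (comoving p.2) p.1))
      (toHubbleMax α) (nhds 1) ∧
    Filter.Tendsto
      (fun p : ℝ × ℝ =>
        speed (powerLaw α) p.1 (fermiVelocity (powerLaw α) (comoving p.2) p.1))
      (toHubbleMax α) (nhds (constC α)) ∧
    -- the limiting Fermi speed is the proper radius of the Fermi space slice divided by `τ`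
    (∀ τ : ℝ, 0 < τ →
      IntervalIntegrable
        (fun t => powerLaw α t / √(powerLaw α τ ^ 2 - powerLaw α t ^ 2))
        MeasureTheory.volume 0 τ ∧
      IsLUB (sliceLengths (powerLaw α) τ) (sliceRadius (powerLaw α) τ) ∧
      constC α = sliceRadius (powerLaw α) τ / τ) := by
  refine ⟨?_, ?_, ?_, ?_⟩
  · rintro τ χ v hτ hχ rfl hmax
    obtain ⟨θ, hθ, hv⟩ := exists_hubbleOfAngle_eq hα hα1 (hubbleSpeed_pos hα hτ hχ) hmax
    have hc := cos_mem_Ioo hθ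
    have hG : funG α (hubbleSpeed α τ χ) ^ (2 * α) = Real.cos θ ^ 2 := by
      rw [← hv, funG_hubbleOfAngle hα hα1 hθ, ← Real.rpow_mul hc.1.le, ← Real.rpow_two]
      congr 1
      field_simp
    have hG1 : funG α (hubbleSpeed α τ χ) ^ (1 - α) = Real.cos θ ^ ((1 - α) / α) := by
      rw [← hv, funG_hubbleOfAngle hα hα1 hθ, ← Real.rpow_mul hc.1.le]
      congr 1
      field_simp
    have hsin : √(1 - Real.cos θ ^ 2) = Real.sin θ := by
      rw [← Real.abs_sin_eq_sqrt_one_sub_cos_sq, abs_of_pos (sin_pos_of_mem hθ)]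
    refine ⟨⟨Real.cos θ, ⟨hc, ?_⟩, ?_⟩, ⟨_, (isKinematicVelocity_iff hα hα1 hτ hθ hv _).2 rfl,
      fun w => (isKinematicVelocity_iff hα hα1 hτ hθ hv w).1⟩,
      ⟨_, (isFermiVelocity_iff hα hα1 hτ hχ hθ hv _).2 rfl,
      fun w => (isFermiVelocity_iff hα hα1 hτ hχ hθ hv w).1⟩, ?_, ?_⟩
    · rw [← hv, funF_cos hα hα1 hθ]
    · rintro z ⟨hz, e⟩
      rw [← hv, ← funF_cos hα hα1 hθ] at e
      exact funF_injOn hα hα1 hz hc e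
    · rw [speed_kinematicVelocity hα hα1 hτ hθ hv, hG, hsin]
    · rw [speed_fermiVelocity hα hα1 hτ hχ hθ hv, hG, hG1, hsin,
        fermiSpeedOfAngle_eq hα hα1 hθ, arcLength_eq hα hα1 θ, hv]
      ring
  · have h := (Real.continuous_sin.tendsto _).comp (tendsto_angleOfParticle hα hα1)
    rw [Real.sin_pi_div_two] at h
    refine h.congr' ?_
    filter_upwards [eventually_mem_toHubbleMax (hubbleMax_pos hα hα1)] with p hp
    obtain ⟨h1, h2⟩ := angleOfParticle_spec hα hα1 hp.1 hp.2.2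
    exact (speed_kinematicVelocity hα hα1 hp.1.1 h1 h2).symm
  · have h := ((continuous_fermiSpeedOfAngle hα).tendsto _).comp (tendsto_angleOfParticle hα hα1)
    rw [fermiSpeedOfAngle_pi_div_two hα] at h
    refine h.congr' ?_
    filter_upwards [eventually_mem_toHubbleMax (hubbleMax_pos hα hα1)] with p hp
    obtain ⟨h1, h2⟩ := angleOfParticle_spec hα hα1 hp.1 hp.2.2
    exact (speed_fermiVelocity hα hα1 hp.1.1 hp.1.2 h1 h2).symm
  · intro τ hτ
    rw [sliceRadius_eq hα hτ]
    exact ⟨intervalIntegrable_sliceRadius hα hτ, isLUB_sliceLengths hα hα1 hτ, by field_simp⟩
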